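/- Let $M$ be a compact oriented smooth manifold (Hausdorff, without boundary) of dimension $n$, i.e. a compact orientable manifold with any choice of orientation, and let $E\to M$ be an odd vector bundle, i.e. a smooth real vector bundle $E=\bigoplus_{k\text{ odd}}E_k$ of finite rank, graded by $\mathbb Z$ and concentrated in odd degrees. Let $C^\infty(E):=\Gamma(\Lambda E^*)$ be the algebra of functions on $E$, with the grading in which the covectors in $(E_k)^*$ have degree $-k$, and let $\mathfrak X(E)$ be the space of vector fields on $E$, i.e. of linear combinations of graded derivations of $C^\infty(E)$; a graded derivation of degree $j$ is a linear map $D$ of degree $j$ with $D(ab)=D(a)b+(-1)^{ij}aD(b)$ for $a$ of degree $i$ and all $b$. A section $\mu$ of $\operatorname{BER}(E):=\Lambda E\otimes\Lambda^nT^*M$ pairs with a function $f$ to an $n$-form $\langle f|\mu\rangle$ on $M$ (the scalar part of $\iota_f\mu$, where $\iota_{fg}=\iota_f\iota_g$), and one sets $\int_E f\,\mu:=\int_M\langle f|\mu\rangle$. A Berezinian form is a smooth section $\mu$ of $\operatorname{BER}(E)$ whose component in $\Lambda^{\mathrm{rank}\,E}E\otimes\Lambda^nT^*M$ vanishes nowhere.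 Then for every Berezinian form $\mu$ on $E$ there is a unique map $\mathrm{div}_\mu\colon\mathfrak X(E)\to C^\infty(E)$ (the divergence operator) such that $$\int_E X(f)\,\mu=-\int_E f\,\mathrm{div}_\mu X\,\mu\qquad\text{for all }X\in\mathfrak X(E),\ f\in C^\infty(E).$$ Moreover, $\mathrm{div}_{c\mu}=\mathrm{div}_\mu$ for every real constant $c\neq0$. -/

import Mathlib

open scoped Manifold ContDiff TensorProduct Topology

noncomputable section

namespace OddBundle

/-! ### Linear algebra: interior product, pairing -/

section Algebra

variable (V : Type*) [AddCommGroup V] [Module ℝ V]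

/-- The interior product `f ↦ ι_f`, an algebra morphism `Λ V* → End (Λ V)` sending a covector `α`
to the contraction by `α`; thus `ι_{f g} = ι_f ∘ ι_g`. -/
def interiorProduct : ExteriorAlgebra ℝ (Module.Dual ℝ V) →ₐ[ℝ] Module.End ℝ (ExteriorAlgebra ℝ V) :=
  ExteriorAlgebra.lift ℝ
    ⟨(CliffordAlgebra.contractLeft (Q := (0 : QuadraticForm ℝ V)) :
        Module.Dual ℝ V →ₗ[ℝ] Module.End ℝ (ExteriorAlgebra ℝ V)), fun α => by
      refine LinearMap.ext fun x => ?_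
      exact CliffordAlgebra.contractLeft_contractLeft (Q := (0 : QuadraticForm ℝ V)) (d := α) x⟩

/-- The pairing `⟨f | u⟩` of `f ∈ Λ V*` with `u ∈ Λ V`: the scalar part of `ι_f u`. It satisfies
`⟨f | ι_g u⟩ = ⟨f g | u⟩`. -/
def pairing : ExteriorAlgebra ℝ (Module.Dual ℝ V) →ₗ[ℝ] ExteriorAlgebra ℝ V →ₗ[ℝ] ℝ :=
  LinearMap.compRight ℝ ExteriorAlgebra.algebraMapInv.toLinearMap ∘ₗ (interiorProduct V).toLinearMap

/-- The pull-back of alternating `n`-forms along a linear map. -/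
def pullbackForm {V W : Type*} [AddCommGroup V] [Module ℝ V] [AddCommGroup W] [Module ℝ W]
    {n : ℕ} (φ : V →ₗ[ℝ] W) : (W [⋀^Fin n]→ₗ[ℝ] ℝ) →ₗ[ℝ] (V [⋀^Fin n]→ₗ[ℝ] ℝ) where
  toFun η := η.compLinearMap φ
  map_add' _ _ := rfl
  map_smul' _ _ := rfl

instance exteriorAlgebra_finite [Module.Finite ℝ V] : Module.Finite ℝ (ExteriorAlgebra ℝ V) := by
  have h : (⊤ : Submodule ℝ (ExteriorAlgebra ℝ V)) =
      ⨆ k ∈ Finset.range (Module.finrank ℝ V + 1), ⋀[ℝ]^k V := by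
    refine le_antisymm ?_ le_top
    intro x _
    induction x using DirectSum.Decomposition.inductionOn fun i => ⋀[ℝ]^i V with
    | zero => exact Submodule.zero_mem _
    | add _ _ hm hm' => exact Submodule.add_mem _ (hm trivial) (hm' trivial)
    | @homogeneous k m =>
      by_cases hk : k ∈ Finset.range (Module.finrank ℝ V + 1)
      · exact (le_iSup₂_of_le (f := fun k (_ : k ∈ Finset.range (Module.finrank ℝ V + 1)) =>
          (⋀[ℝ]^k V)) k hk le_rfl) m.2
      · have h0 : Module.finrank ℝ (⋀[ℝ]^k V) = 0 := by
          rw [exteriorPower.finrank_eq, Nat.choose_eq_zero_of_lt]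
          simpa using hk
        have := Module.finrank_zero_iff.1 h0
        rw [Subsingleton.elim m 0]
        exact Submodule.zero_mem _
  refine ⟨?_⟩
  rw [h]
  exact Submodule.fg_biSup _ _ fun k _ => (Module.Finite.iff_fg).1 inferInstance

end Algebra

/-! ### Orientations and integration of top-degree forms on a manifold -/

section Integration

variable {n : ℕ} {M : Type*} [TopologicalSpace M] [ChartedSpace (EuclideanSpace ℝ (Fin n)) M]
  [IsManifold (𝓡 n) ∞ M]

/-- The trivialization of `TM` given by the chosen chart around `p`. -/
abbrev tangentTriv (n : ℕ) {M : Type*} [TopologicalSpace M]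
    [ChartedSpace (EuclideanSpace ℝ (Fin n)) M] [IsManifold (𝓡 n) ∞ M] (p : M) :
    Bundle.Trivialization (EuclideanSpace ℝ (Fin n))
      (Bundle.TotalSpace.proj :
        Bundle.TotalSpace (EuclideanSpace ℝ (Fin n)) (TangentSpace (𝓡 n) : M → Type _) → M) :=
  trivializationAt (EuclideanSpace ℝ (Fin n)) (TangentSpace (𝓡 n)) p

/-- The coordinate basis `∂₁, …, ∂ₙ` of `T_xM` for the chart around `p`. -/
def coordBasis (p x : M) (hx : x ∈ (tangentTriv n p).baseSet) :
    Module.Basis (Fin n) ℝ (TangentSpace (𝓡 n) x) :=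
  (EuclideanSpace.basisFun (Fin n) ℝ).toBasis.map ((tangentTriv n p).linearEquivAt ℝ x hx).symm

open Classical in
/-- `+1` or `-1` as the coordinate basis at `x` of the chart around `p` is positive or negative. -/
def chartSign (o : ∀ x : M, Orientation ℝ (TangentSpace (𝓡 n) x) (Fin n)) (p x : M) : ℝ :=
  if hx : x ∈ (tangentTriv n p).baseSet then
    if (coordBasis p x hx).orientation = o x then 1 else -1
  else 0

variable (n M) in
/-- An orientation of `M`: orientations of the tangent spaces that are locally constant in charts. -/
structure ManifoldOrientation where
  orient : ∀ x : M, Orientation ℝ (TangentSpace (𝓡 n) x) (Fin n)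
  locallyConst : ∀ p : M, ∀ x ∈ (tangentTriv n p).baseSet,
    ∀ᶠ y in 𝓝 x, chartSign orient p y = chartSign orient p x

/-- `Λᵗᵒᵖ T_x*M`. -/
abbrev TopForm (n : ℕ) {M : Type*} [TopologicalSpace M]
    [ChartedSpace (EuclideanSpace ℝ (Fin n)) M] (x : M) : Type :=
  TangentSpace (𝓡 n) x [⋀^Fin n]→ₗ[ℝ] ℝ

variable (n M) in
/-- A smooth partition of unity subordinate to the cover of `M` by the chart domains. -/
def chartPartition [T2Space M] [SigmaCompactSpace M] :
    SmoothPartitionOfUnity M (𝓡 n) M Set.univ :=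
  (SmoothPartitionOfUnity.exists_isSubordinate_chartAt_source (𝓡 n) M).choose

/-- The integral over the oriented manifold `M` of a form `η` of top degree, through a partition of
unity `(ρ_p)`: the sum of the integrals of `± ρ_p η(∂₁, …, ∂ₙ)` over the chart images. -/
def formIntegral [T2Space M] [SigmaCompactSpace M] (o : ManifoldOrientation n M)
    (η : ∀ x : M, TopForm n x) : ℝ :=
  ∑ᶠ p : M, ∫ y in (extChartAt (𝓡 n) p).target,
    chartPartition n M p ((extChartAt (𝓡 n) p).symm y) *
      (chartSign o.orient p ((extChartAt (𝓡 n) p).symm y) *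
        η ((extChartAt (𝓡 n) p).symm y) fun i =>
          (tangentTriv n p).symmₗ ℝ ((extChartAt (𝓡 n) p).symm y) (EuclideanSpace.single i 1))

end Integration

/-! ### Odd vector bundles -/

section Bundle

variable {n : ℕ} {M : Type*} [TopologicalSpace M] [ChartedSpace (EuclideanSpace ℝ (Fin n)) M]
  [IsManifold (𝓡 n) ∞ M]
  (F : Type*) [NormedAddCommGroup F] [NormedSpace ℝ F] [FiniteDimensional ℝ F]
  (E : M → Type*) [∀ x, AddCommGroup (E x)] [∀ x, Module ℝ (E x)]
  [∀ x, TopologicalSpace (E x)] [TopologicalSpace (Bundle.TotalSpace F E)]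
  [FiberBundle F E] [VectorBundle ℝ F E]

variable (n) in
/-- A `ℤ`-grading of the vector bundle `E` concentrated in odd degrees: each fibre is the direct sum
of its homogeneous pieces `E_k`, `k` odd, and there are smooth local frames of homogeneous sections
(so that the transition functions between such frames preserve degrees). -/
structure OddGrading where
  piece : ∀ x : M, ℤ → Submodule ℝ (E x)
  isInternal : ∀ x, DirectSum.IsInternal (piece x)
  piece_even : ∀ x k, Even k → piece x k = ⊥
  exists_frame : ∀ p : M, ∃ U ∈ 𝓝 p, ∃ (s : Fin (Module.finrank ℝ F) → ∀ x : M, E x)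
    (d : Fin (Module.finrank ℝ F) → ℤ),
    IsLocalFrameOn (𝓡 n) F ∞ s U ∧ ∀ i, ∀ x ∈ U, s i x ∈ piece x (d i)

/-- The coordinate expression `Λ E_x* → Λ F*` in the local trivialization of `E` around `p`. -/
def funCoord (p x : M) :
    ExteriorAlgebra ℝ (Module.Dual ℝ (E x)) →ₐ[ℝ] ExteriorAlgebra ℝ (Module.Dual ℝ F) :=
  ExteriorAlgebra.map ((trivializationAt F E p).symmₗ ℝ x).dualMap

variable (n) in
/-- The algebra `C^∞(E) = Γ(Λ E*)` of functions on the odd vector bundle `E`: sections of `Λ E*`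
whose expressions in the local trivializations, with values in the finite-dimensional space `Λ F*`,
have smooth components. -/
def Func : Subalgebra ℝ (∀ x : M, ExteriorAlgebra ℝ (Module.Dual ℝ (E x))) where
  carrier := {f | ∀ p : M, ∀ l : ExteriorAlgebra ℝ (Module.Dual ℝ F) →ₗ[ℝ] ℝ,
    ContMDiffOn (𝓡 n) 𝓘(ℝ, ℝ) ∞ (fun x => l (funCoord F E p x (f x)))
      (trivializationAt F E p).baseSet}
  mul_mem' := by
    intro f g hf hg p l
    let b := Module.finBasis ℝ (ExteriorAlgebra ℝ (Module.Dual ℝ F))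
    have key : ∀ u v : ExteriorAlgebra ℝ (Module.Dual ℝ F),
        l (u * v) = ∑ i, ∑ j, b.coord i u * b.coord j v * l (b i * b j) := by
      intro u v
      conv_lhs => rw [← b.sum_repr u, ← b.sum_repr v]
      simp only [Finset.sum_mul_sum, map_sum, smul_mul_smul_comm, map_smul, smul_eq_mul,
        Module.Basis.coord_apply]
    have : (fun x => l (funCoord F E p x ((f * g) x))) = fun x => ∑ i, ∑ j,
        b.coord i (funCoord F E p x (f x)) * b.coord j (funCoord F E p x (g x)) *
          l (b i * b j) := by
      funext x
      rw [Pi.mul_apply, map_mul, key]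
    rw [this]
    exact contMDiffOn_finsetSum fun i _ => contMDiffOn_finsetSum fun j _ =>
      ((hf p (b.coord i)).mul (hg p (b.coord j))).mul contMDiffOn_const
  add_mem' := by
    intro f g hf hg p l
    refine ((hf p l).add (hg p l)).congr fun x _ => ?_
    simp
  algebraMap_mem' := by
    intro r p l
    simpa using contMDiffOn_const

variable {F E}

/-- Covectors of degree `j`, i.e. `(E*)_j = (E_{-j})*`: those that vanish on `E_k` for `k ≠ -j`. -/
def OddGrading.IsHomogeneousCovector (gr : OddGrading n F E) (x : M) (j : ℤ)
    (α : Module.Dual ℝ (E x)) : Prop :=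
  ∀ k, k ≠ -j → ∀ v ∈ gr.piece x k, α v = 0

/-- The degree `d` part of `Λ E_x*`, spanned by the products of homogeneous covectors of total
degree `d`. -/
def OddGrading.funPiece (gr : OddGrading n F E) (x : M) (d : ℤ) :
    Submodule ℝ (ExteriorAlgebra ℝ (Module.Dual ℝ (E x))) :=
  Submodule.span ℝ {a | ∃ L : List (ℤ × Module.Dual ℝ (E x)),
    (∀ q ∈ L, gr.IsHomogeneousCovector x q.1 q.2) ∧ (L.map Prod.fst).sum = d ∧
      a = (L.map fun q => ExteriorAlgebra.ι ℝ q.2).prod}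

/-- Functions on `E` homogeneous of degree `d`. -/
def OddGrading.IsHomogeneous (gr : OddGrading n F E) (d : ℤ) (f : Func n F E) : Prop :=
  ∀ x, f.1 x ∈ gr.funPiece x d

/-- Graded derivations of degree `j` of the graded algebra `C^∞(E)`. -/
def OddGrading.IsGradedDerivation (gr : OddGrading n F E) (j : ℤ)
    (D : Module.End ℝ (Func n F E)) : Prop :=
  (∀ d f, gr.IsHomogeneous d f → gr.IsHomogeneous (d + j) (D f)) ∧
    ∀ d f g, gr.IsHomogeneous d f →
      D (f * g) = D f * g + ((Int.negOnePow (d * j) : ℤˣ) : ℤ) • (f * D g)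

/-- Vector fields on `E`: linear combinations of graded derivations of `C^∞(E)`. -/
def OddGrading.VectorField (gr : OddGrading n F E) : Submodule ℝ (Module.End ℝ (Func n F E)) :=
  Submodule.span ℝ {D | ∃ j, gr.IsGradedDerivation j D}

/-! ### Berezinian forms and integration -/

variable (n E) in
/-- The fibre `Λ E_x ⊗ Λᵗᵒᵖ T_x*M` of the Berezinian bundle `BER(E)`. -/
abbrev BerFiber (x : M) := ExteriorAlgebra ℝ (E x) ⊗[ℝ] TopForm n x

variable (F E) in
/-- The expression of elements of `BER(E)_x` in the local trivializations of `E` and `TM`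
around `p`. -/
def berCoord (p x : M) : BerFiber n E x →ₗ[ℝ]
    ExteriorAlgebra ℝ F ⊗[ℝ] (EuclideanSpace ℝ (Fin n) [⋀^Fin n]→ₗ[ℝ] ℝ) :=
  TensorProduct.map (ExteriorAlgebra.map ((trivializationAt F E p).linearMapAt ℝ x)).toLinearMap
    (pullbackForm ((tangentTriv n p).symmₗ ℝ x))

variable (n F E) in
/-- Smooth sections of the Berezinian bundle `BER(E) = Λ E ⊗ Λᵗᵒᵖ T*M`. -/
def BerSection : Submodule ℝ (∀ x : M, BerFiber n E x) where
  carrier := {μ | ∀ p : M, ∀ l : ExteriorAlgebra ℝ F ⊗[ℝ]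
      (EuclideanSpace ℝ (Fin n) [⋀^Fin n]→ₗ[ℝ] ℝ) →ₗ[ℝ] ℝ,
    ContMDiffOn (𝓡 n) 𝓘(ℝ, ℝ) ∞ (fun x => l (berCoord F E p x (μ x)))
      ((trivializationAt F E p).baseSet ∩ (tangentTriv n p).baseSet)}
  add_mem' := by
    intro μ ν hμ hν p l
    refine ((hμ p l).add (hν p l)).congr fun x _ => ?_
    simp
  zero_mem' := by
    intro p l
    simpa using contMDiffOn_const
  smul_mem' := by
    intro c μ hμ p l
    refine (contMDiffOn_const (c := c)).mul (hμ p l) |>.congr fun x _ => ?_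
    simp

/-- A Berezinian form on `E`: a section of `BER(E)` whose top component, the one in
`Λᵗᵒᵖ E ⊗ Λᵗᵒᵖ T*M`, vanishes nowhere. -/
def IsBerezinianForm (μ : BerSection n F E) : Prop :=
  ∀ x, TensorProduct.map
    (GradedAlgebra.proj (fun i : ℕ => ⋀[ℝ]^i (E x)) (Module.finrank ℝ (E x)))
    (LinearMap.id : TopForm n x →ₗ[ℝ] TopForm n x) (μ.1 x) ≠ 0

/-- The form `⟨f | μ⟩` of top degree on `M`. -/
def berPairing (f : Func n F E) (μ : BerSection n F E) (x : M) : TopForm n x :=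
  TensorProduct.lid ℝ (TopForm n x)
    (TensorProduct.map (pairing (E x) (f.1 x)) LinearMap.id (μ.1 x))

/-- The Berezinian integral `∫_E f μ = ∫_M ⟨f | μ⟩`. -/
def berIntegral [T2Space M] [SigmaCompactSpace M] (o : ManifoldOrientation n M)
    (f : Func n F E) (μ : BerSection n F E) : ℝ :=
  formIntegral o (berPairing f μ)

/-- `D` is a divergence operator for `μ`: `∫ X(f) μ = - ∫ f (D X) μ` for all vector fields `X` and
all functions `f`. -/
def IsDivergence [T2Space M] [SigmaCompactSpace M] (o : ManifoldOrientation n M)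
    (gr : OddGrading n F E) (μ : BerSection n F E) (D : gr.VectorField → Func n F E) : Prop :=
  ∀ (X : gr.VectorField) (f : Func n F E),
    berIntegral o (X.1 f) μ = - berIntegral o (f * D X) μ

end Bundle

end OddBundle

end

/-!
Fix a Berezinian form `μ`, and write `I f = ∫_E f μ`.

*Duality.* At a point `x` the bilinear form `(f, g) ↦ ⟨f g | μ⟩` on `Λ E_x*` is nondegenerate: a
nonzero left ideal of `Λ E_x*` meets the top degree (`exists_mul_mem_top`), and the top degree, a
line, pairs nontrivially with the top component of `μ` (`exists_pairing_mul_ne_zero`). By Cramer's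
rule the inverse of its matrix in a local trivialization is smooth, so that each smooth family of
linear maps `Λ E_x* → Λᵗᵒᵖ T_x*M` is of the form `f ↦ ⟨f g | μ⟩` with a unique function `g` on `E`
(`exists_func_berPairing_mul_eq`).

*Uniqueness.* If `I (f g) = 0` for all `f`, then replacing `f` by its products with smooth functions
on `M` and using the fundamental lemma of the calculus of variations
(`eq_zero_of_forall_formIntegral_smul_eq_zero`) shows that `⟨f g | μ⟩ = 0` for all `f`, hence
`g = 0` by nondegeneracy (`eq_zero_of_forall_berIntegral_eq_zero`).

*Existence.* With a partition of unity, `f = ∑ h_α θ_α`, where the `θ_α` are finitely many fixed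
functions on `E` and the coefficients `h_α`, smooth functions on `M`, depend `C^∞(M)`-linearly on
`f` (`eq_sum_coefficient_mul`). Functions on `M` have degree `0`, so the Leibniz rule gives
`X f = ∑ X(h_α) θ_α + h_α X(θ_α)` for every vector field `X`, without signs. The form
`h_α ⟨X(θ_α) | μ⟩` is `C^∞(M)`-linear in `f`, and duality applies to it. The map
`h ↦ ⟨X(h) θ_α | μ⟩` is a derivation of `C^∞(M)` with values in the forms of top degree. By
Hadamard's lemma (`exists_hadamard`) it is a combination of partial derivatives in each chart
(`derivation_eq_sum`), and integration by parts turns it, under the integral, into the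
multiplication with a form (`exists_divergence_form`); then duality applies again.

The integral over `M` is defined by a partition of unity subordinate to the charts. That a form
supported in one chart can be integrated in that chart (`formIntegral_eq_chartIntegral`) is the
change of variables formula, the orientation absorbing the sign of the Jacobian determinant.
-/

noncomputable section

namespace OddBundle

/-! ### The pairing of `Λ V*` with `Λ V` -/

section Pairing

variable {V W : Type*} [AddCommGroup V] [Module ℝ V] [AddCommGroup W] [Module ℝ W]

lemma interiorProduct_ι_ι_mul (α : Module.Dual ℝ V) (v : V) (x : ExteriorAlgebra ℝ V) :
    interiorProduct V (ExteriorAlgebra.ι ℝ α) (ExteriorAlgebra.ι ℝ v * x) =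
      α v • x - ExteriorAlgebra.ι ℝ v * interiorProduct V (ExteriorAlgebra.ι ℝ α) x := by
  rw [interiorProduct, ExteriorAlgebra.lift_ι_apply]
  exact CliffordAlgebra.contractLeft_ι_mul _ _ _

lemma interiorProduct_ι_algebraMap (α : Module.Dual ℝ V) (r : ℝ) :
    interiorProduct V (ExteriorAlgebra.ι ℝ α) (algebraMap ℝ _ r) = 0 := by
  rw [interiorProduct, ExteriorAlgebra.lift_ι_apply]
  exact CliffordAlgebra.contractLeft_algebraMap _ _ _

lemma mem_exteriorPower_zero_iff {x : ExteriorAlgebra ℝ V} :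
    x ∈ ⋀[ℝ]^0 V ↔ ∃ r, algebraMap ℝ _ r = x := by
  rw [ExteriorAlgebra.exteriorPower, pow_zero, Submodule.mem_one]

lemma ι_mul_mem_exteriorPower (v : V) {k : ℕ} {x : ExteriorAlgebra ℝ V} (hx : x ∈ ⋀[ℝ]^k V) :
    ExteriorAlgebra.ι ℝ v * x ∈ ⋀[ℝ]^(k + 1) V := by
  rw [ExteriorAlgebra.exteriorPower, pow_succ']
  exact Submodule.mul_mem_mul (LinearMap.mem_range_self _ v) hx

lemma mul_ι_mem_exteriorPower (v : V) {k : ℕ} {x : ExteriorAlgebra ℝ V} (hx : x ∈ ⋀[ℝ]^k V) :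
    x * ExteriorAlgebra.ι ℝ v ∈ ⋀[ℝ]^(k + 1) V := by
  rw [ExteriorAlgebra.exteriorPower, pow_succ]
  exact Submodule.mul_mem_mul hx (LinearMap.mem_range_self _ v)

lemma interiorProduct_ι_mem (α : Module.Dual ℝ V) (k : ℕ) :
    ∀ x ∈ ⋀[ℝ]^(k + 1) V, interiorProduct V (ExteriorAlgebra.ι ℝ α) x ∈ ⋀[ℝ]^k V := by
  induction k with
  | zero =>
    intro x hx
    rw [ExteriorAlgebra.exteriorPower, zero_add, pow_one] at hx
    obtain ⟨v, rfl⟩ := hx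
    have := interiorProduct_ι_ι_mul α v 1
    rw [mul_one] at this
    rw [this, ← (algebraMap ℝ (ExteriorAlgebra ℝ V)).map_one, interiorProduct_ι_algebraMap,
      mul_zero, sub_zero, mem_exteriorPower_zero_iff]
    exact ⟨α v, by rw [map_one, Algebra.algebraMap_eq_smul_one]⟩
  | succ k ih =>
    intro x hx
    rw [ExteriorAlgebra.exteriorPower, pow_succ'] at hx
    induction hx using Submodule.mul_induction_on' with
    | mem_mul_mem v hv y hy =>
      obtain ⟨v, rfl⟩ := hv
      rw [interiorProduct_ι_ι_mul]
      exact Submodule.sub_mem _ (Submodule.smul_mem _ _ hy) (ι_mul_mem_exteriorPower v (ih y hy))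
    | add y _ z _ hy hz => rw [map_add]; exact Submodule.add_mem _ hy hz

/-- Euler's identity: the operator `∑ eᵢ ∧ (eⁱ ⌟ ·)` is multiplication by `k` on `Λᵏ V`. -/
lemma sum_ι_mul_interiorProduct {κ : Type*} [Fintype κ] (b : Module.Basis κ ℝ V) (k : ℕ) :
    ∀ x ∈ ⋀[ℝ]^k V, ∑ i, ExteriorAlgebra.ι ℝ (b i) *
      interiorProduct V (ExteriorAlgebra.ι ℝ (b.coord i)) x = (k : ℝ) • x := by
  induction k with
  | zero =>
    intro x hx
    obtain ⟨r, rfl⟩ := mem_exteriorPower_zero_iff.1 hx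
    simp [interiorProduct_ι_algebraMap]
  | succ k ih =>
    intro x hx
    rw [ExteriorAlgebra.exteriorPower, pow_succ'] at hx
    induction hx using Submodule.mul_induction_on' with
    | mem_mul_mem v hv y hy =>
      obtain ⟨v, rfl⟩ := hv
      have h1 : ∀ i, ExteriorAlgebra.ι ℝ (b i) * interiorProduct V
          (ExteriorAlgebra.ι ℝ (b.coord i)) (ExteriorAlgebra.ι ℝ v * y) =
          ExteriorAlgebra.ι ℝ (b.coord i v • b i) * y + ExteriorAlgebra.ι ℝ v *
            (ExteriorAlgebra.ι ℝ (b i) *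
              interiorProduct V (ExteriorAlgebra.ι ℝ (b.coord i)) y) := by
        intro i
        -- `eᵢ ∧ v = -v ∧ eᵢ`, so that the operator is a derivation fixing `v`
        have h2 := ExteriorAlgebra.ι_add_mul_swap (R := ℝ) (b i) v
        rw [interiorProduct_ι_ι_mul, mul_sub, ← mul_assoc, eq_neg_of_add_eq_zero_left h2]
        simp [mul_assoc]
      simp_rw [h1]
      rw [Finset.sum_add_distrib, ← Finset.sum_mul, ← Finset.mul_sum, ih y hy, ← map_sum]
      simp only [Module.Basis.coord_apply, b.sum_repr, mul_smul_comm]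
      push_cast
      rw [add_smul, one_smul, add_comm]
    | add y _ z _ hy hz =>
      simp only [map_add, mul_add, Finset.sum_add_distrib, hy, hz, smul_add]

lemma exteriorPower_eq_zero_of_finrank_lt [FiniteDimensional ℝ V] {k : ℕ}
    (hk : Module.finrank ℝ V < k) {x : ExteriorAlgebra ℝ V} (hx : x ∈ ⋀[ℝ]^k V) : x = 0 := by
  have h0 : Module.finrank ℝ (⋀[ℝ]^k V) = 0 := by
    rw [exteriorPower.finrank_eq, Nat.choose_eq_zero_of_lt hk]
  have := Module.finrank_zero_iff.1 h0
  exact congrArg Subtype.val (Subsingleton.elim (⟨x, hx⟩ : ⋀[ℝ]^k V) 0)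

/-- An element of the exterior algebra that is killed by all vectors is of top degree: on `Λᵏ V`,
`∑ eⁱ ⌟ (eᵢ ∧ ·)` is multiplication by `dim V - k`. -/
lemma mem_top_of_forall_ι_mul_eq_zero [FiniteDimensional ℝ V] {x : ExteriorAlgebra ℝ V}
    (hx : ∀ v : V, ExteriorAlgebra.ι ℝ v * x = 0) : x ∈ ⋀[ℝ]^(Module.finrank ℝ V) V := by
  have key : ∀ k, k ≠ Module.finrank ℝ V →
      (DirectSum.decompose (fun i : ℕ => ⋀[ℝ]^i V) x k : ExteriorAlgebra ℝ V) = 0 := by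
    intro k hk
    set y := (DirectSum.decompose (fun i : ℕ => ⋀[ℝ]^i V) x k : ExteriorAlgebra ℝ V) with hy
    have hym : y ∈ ⋀[ℝ]^k V := SetLike.coe_mem _
    have h1 : ∀ v : V, ExteriorAlgebra.ι ℝ v * y = 0 := by
      intro v
      have hv : ExteriorAlgebra.ι ℝ v ∈ ⋀[ℝ]^1 V := by
        rw [ExteriorAlgebra.exteriorPower, pow_one]; exact LinearMap.mem_range_self _ v
      have := DirectSum.coe_decompose_mul_add_of_left_mem (fun i : ℕ => ⋀[ℝ]^i V)
        (j := k) (b := x) hv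
      rw [hx v] at this
      simpa using this.symm
    let b := Module.finBasis ℝ V
    have h2 := sum_ι_mul_interiorProduct b k y hym
    have h3 : ∀ i, ExteriorAlgebra.ι ℝ (b i) *
        interiorProduct V (ExteriorAlgebra.ι ℝ (b.coord i)) y = y := by
      intro i
      have := interiorProduct_ι_ι_mul (b.coord i) (b i) y
      rw [h1, map_zero] at this
      simpa using (sub_eq_zero.1 this.symm).symm
    simp only [h3, Finset.sum_const, Finset.card_univ, Fintype.card_fin] at h2
    rw [← Nat.cast_smul_eq_nsmul ℝ, ← sub_eq_zero, ← sub_smul] at h2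
    refine (smul_eq_zero.1 h2).resolve_left ?_
    rw [← ne_eq, sub_ne_zero]
    exact_mod_cast hk.symm
  classical
  rw [← DirectSum.sum_support_decompose (fun i : ℕ => ⋀[ℝ]^i V) x]
  refine Submodule.sum_mem _ fun k _ => ?_
  by_cases hk : k = Module.finrank ℝ V
  · subst hk; exact SetLike.coe_mem _
  · rw [key k hk]; exact Submodule.zero_mem _

/-- Every nonzero left ideal of the exterior algebra meets the top degree. -/
lemma exists_mul_mem_top [FiniteDimensional ℝ V] {f : ExteriorAlgebra ℝ V} (hf : f ≠ 0) :
    ∃ g, g * f ∈ ⋀[ℝ]^(Module.finrank ℝ V) V ∧ g * f ≠ 0 := by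
  by_contra! hcon
  -- otherwise a multiple outside the top degree is not killed by all vectors, and there are nonzero
  -- multiples `g f` with `g` of arbitrarily high degree
  have : ∀ k : ℕ, ∃ g ∈ ⋀[ℝ]^k V, g * f ≠ 0 := by
    intro k
    induction k with
    | zero => exact ⟨1, mem_exteriorPower_zero_iff.2 ⟨1, map_one _⟩, by simpa using hf⟩
    | succ k ih =>
      obtain ⟨g, hg, hgf⟩ := ih
      by_cases h : ∀ v : V, ExteriorAlgebra.ι ℝ v * (g * f) = 0
      · exact absurd (hcon g (mem_top_of_forall_ι_mul_eq_zero h)) hgf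
      · push Not at h
        obtain ⟨v, hv⟩ := h
        exact ⟨ExteriorAlgebra.ι ℝ v * g, ι_mul_mem_exteriorPower v hg, by rwa [mul_assoc]⟩
  obtain ⟨g, hg, hgf⟩ := this (Module.finrank ℝ V + 1)
  rw [exteriorPower_eq_zero_of_finrank_lt (Nat.lt_succ_self _) hg, zero_mul] at hgf
  exact hgf rfl

lemma pairing_apply (f : ExteriorAlgebra ℝ (Module.Dual ℝ V)) (u : ExteriorAlgebra ℝ V) :
    pairing V f u = ExteriorAlgebra.algebraMapInv (interiorProduct V f u) := rfl

lemma pairing_mul (f g : ExteriorAlgebra ℝ (Module.Dual ℝ V)) (u : ExteriorAlgebra ℝ V) :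
    pairing V (f * g) u = pairing V f (interiorProduct V g u) := by
  rw [pairing_apply, pairing_apply, map_mul, Module.End.mul_apply]

lemma algebraMapInv_eq_zero_of_mem {k : ℕ} {x : ExteriorAlgebra ℝ V} (hx : x ∈ ⋀[ℝ]^(k + 1) V) :
    ExteriorAlgebra.algebraMapInv (R := ℝ) x = 0 := by
  rw [ExteriorAlgebra.exteriorPower, pow_succ'] at hx
  induction hx using Submodule.mul_induction_on' with
  | mem_mul_mem v hv y hy =>
    obtain ⟨v, rfl⟩ := hv
    simp [ExteriorAlgebra.algebraMapInv]
  | add y _ z _ hy hz => rw [map_add, hy, hz, add_zero]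

lemma pairing_eq_zero_of_ne (m : ℕ) : ∀ k ≠ m, ∀ f ∈ ⋀[ℝ]^m (Module.Dual ℝ V),
    ∀ u ∈ ⋀[ℝ]^k V, pairing V f u = 0 := by
  induction m with
  | zero =>
    intro k hk f hf u hu
    obtain ⟨r, rfl⟩ := mem_exteriorPower_zero_iff.1 hf
    obtain ⟨k, rfl⟩ := Nat.exists_eq_succ_of_ne_zero hk
    rw [pairing_apply, AlgHom.commutes, Module.algebraMap_end_apply, map_smul,
      algebraMapInv_eq_zero_of_mem hu, smul_zero]
  | succ m ih =>
    intro k hk f hf u hu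
    rw [ExteriorAlgebra.exteriorPower, pow_succ] at hf
    induction hf using Submodule.mul_induction_on' with
    | mem_mul_mem g hg α hα =>
      obtain ⟨α, rfl⟩ := hα
      rw [pairing_mul]
      cases k with
      | zero =>
        obtain ⟨r, rfl⟩ := mem_exteriorPower_zero_iff.1 hu
        rw [interiorProduct_ι_algebraMap, map_zero]
      | succ k => exact ih k (by omega) g hg _ (interiorProduct_ι_mem α k u hu)
    | add y _ z _ hy hz => rw [map_add, LinearMap.add_apply, hy, hz, add_zero]

lemma exists_pairing_ne_zero [FiniteDimensional ℝ V] (k : ℕ) :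
    ∀ u ∈ ⋀[ℝ]^k V, u ≠ 0 → ∃ f ∈ ⋀[ℝ]^k (Module.Dual ℝ V), pairing V f u ≠ 0 := by
  induction k with
  | zero =>
    intro u hu hu0
    obtain ⟨r, rfl⟩ := mem_exteriorPower_zero_iff.1 hu
    refine ⟨1, mem_exteriorPower_zero_iff.2 ⟨1, map_one _⟩, ?_⟩
    rw [pairing_apply, map_one, Module.End.one_apply, ExteriorAlgebra.algebraMap_leftInverse]
    rintro rfl
    exact hu0 (map_zero _)
  | succ k ih =>
    intro u hu hu0
    let b := Module.finBasis ℝ V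
    have h2 := sum_ι_mul_interiorProduct b (k + 1) u hu
    have h3 : ∃ i, interiorProduct V (ExteriorAlgebra.ι ℝ (b.coord i)) u ≠ 0 := by
      by_contra! h
      simp only [h, mul_zero, Finset.sum_const_zero] at h2
      exact hu0 ((smul_eq_zero.1 h2.symm).resolve_left (by positivity))
    obtain ⟨i, hi⟩ := h3
    obtain ⟨f, hf, hfu⟩ := ih _ (interiorProduct_ι_mem _ k u hu) hi
    exact ⟨f * ExteriorAlgebra.ι ℝ (b.coord i), mul_ι_mem_exteriorPower _ hf, by rwa [pairing_mul]⟩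

/-- An element of `Λᵐ V*` only sees the component of degree `m`. -/
lemma pairing_eq_pairing_proj {m : ℕ} {f : ExteriorAlgebra ℝ (Module.Dual ℝ V)}
    (hf : f ∈ ⋀[ℝ]^m (Module.Dual ℝ V)) (u : ExteriorAlgebra ℝ V) :
    pairing V f u = pairing V f (GradedAlgebra.proj (fun i : ℕ => ⋀[ℝ]^i V) m u) := by
  rw [GradedAlgebra.proj_apply]
  induction u using DirectSum.Decomposition.inductionOn fun i : ℕ => ⋀[ℝ]^i V with
  | zero => simp
  | @homogeneous k u =>
    by_cases hk : k = m
    · subst hk; simp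
    · rw [pairing_eq_zero_of_ne m k hk f hf u u.2, DirectSum.decompose_coe,
        DirectSum.of_eq_of_ne _ _ _ (Ne.symm hk)]
      simp
  | add u v hu hv => simp [hu, hv]

/-- If the top component of `u ∈ Λ V` does not vanish, then `(f, g) ↦ ⟨g f | u⟩` is a nondegenerate
bilinear form on `Λ V*`. -/
theorem exists_pairing_mul_ne_zero [FiniteDimensional ℝ V] {u : ExteriorAlgebra ℝ V}
    (hu : GradedAlgebra.proj (fun i : ℕ => ⋀[ℝ]^i V) (Module.finrank ℝ V) u ≠ 0)
    {f : ExteriorAlgebra ℝ (Module.Dual ℝ V)} (hf : f ≠ 0) : ∃ g, pairing V (g * f) u ≠ 0 := by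
  obtain ⟨g, hg, hgf⟩ := exists_mul_mem_top hf
  rw [Subspace.dual_finrank_eq] at hg
  refine ⟨g, ?_⟩
  rw [pairing_eq_pairing_proj hg]
  obtain ⟨h, hh, hhu⟩ := exists_pairing_ne_zero _ _
    (show GradedAlgebra.proj (fun i : ℕ => ⋀[ℝ]^i V) (Module.finrank ℝ V) u ∈ _ by
      rw [GradedAlgebra.proj_apply]; exact SetLike.coe_mem _) hu
  -- `⋀ᵗᵒᵖ V*` is a line, so that `h` is a multiple of `g f`.
  have h1 : Module.finrank ℝ (⋀[ℝ]^(Module.finrank ℝ V) (Module.Dual ℝ V)) = 1 := by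
    rw [exteriorPower.finrank_eq, Subspace.dual_finrank_eq, Nat.choose_self]
  obtain ⟨c, hc⟩ := (finrank_eq_one_iff_of_nonzero' (⟨g * f, hg⟩ :
    ⋀[ℝ]^(Module.finrank ℝ V) (Module.Dual ℝ V)) (by simpa using hgf)).1 h1 ⟨h, hh⟩
  have hc' : c • (g * f) = h := congrArg Subtype.val hc
  intro h0
  rw [← hc', map_smul, LinearMap.smul_apply, h0, smul_zero] at hhu
  exact hhu rfl

/-- The interior product is natural in the vector space. -/
lemma interiorProduct_map (φ : V →ₗ[ℝ] W) (f : ExteriorAlgebra ℝ (Module.Dual ℝ W)) :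
    ∀ u : ExteriorAlgebra ℝ V, interiorProduct W f (ExteriorAlgebra.map φ u) =
      ExteriorAlgebra.map φ (interiorProduct V (ExteriorAlgebra.map φ.dualMap f) u) := by
  induction f using ExteriorAlgebra.induction with
  | algebraMap r => intro u; simp [Module.algebraMap_end_apply]
  | ι α =>
    intro u
    rw [ExteriorAlgebra.map_apply_ι]
    induction u using CliffordAlgebra.left_induction with
    | algebraMap r =>
      have h := interiorProduct_ι_algebraMap (φ.dualMap α) r
      rw [AlgHom.commutes, interiorProduct_ι_algebraMap]
      exact ((congrArg _ h).trans (map_zero _)).symm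
    | add x y hx hy => simp only [map_add, hx, hy]
    | ι_mul x v hx =>
      have h := interiorProduct_ι_ι_mul (φ.dualMap α) v x
      change _ = ExteriorAlgebra.map φ (interiorProduct V (ExteriorAlgebra.ι ℝ (φ.dualMap α))
        (ExteriorAlgebra.ι ℝ v * x))
      change interiorProduct W _ (ExteriorAlgebra.map φ (ExteriorAlgebra.ι ℝ v * x)) = _
      rw [h, map_mul, ExteriorAlgebra.map_apply_ι, interiorProduct_ι_ι_mul, hx, map_sub, map_smul,
        map_mul, ExteriorAlgebra.map_apply_ι]
      rfl
  | mul f g hf hg => intro u; rw [map_mul, map_mul, map_mul, Module.End.mul_apply, hg, hf]; rfl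
  | add f g hf hg => intro u; simp only [map_add, LinearMap.add_apply, hf, hg]

lemma pairing_map (φ : V →ₗ[ℝ] W) (f : ExteriorAlgebra ℝ (Module.Dual ℝ W))
    (u : ExteriorAlgebra ℝ V) : pairing W f (ExteriorAlgebra.map φ u) =
      pairing V (ExteriorAlgebra.map φ.dualMap f) u := by
  rw [pairing_apply, interiorProduct_map, pairing_apply]
  generalize interiorProduct V (ExteriorAlgebra.map φ.dualMap f) u = w
  have : (ExteriorAlgebra.algebraMapInv (R := ℝ) (M := W)).comp (ExteriorAlgebra.map φ) =
      ExteriorAlgebra.algebraMapInv := by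
    ext v
    simp [ExteriorAlgebra.algebraMapInv]
  exact DFunLike.congr_fun this w

end Pairing

/-! ### Forms of top degree in charts -/

section Forms

open Bundle MeasureTheory

variable {n : ℕ} {M : Type*} [TopologicalSpace M] [ChartedSpace (EuclideanSpace ℝ (Fin n)) M]

lemma contMDiffAt_det {f : M → EuclideanSpace ℝ (Fin n) →L[ℝ] EuclideanSpace ℝ (Fin n)} {x : M}
    (hf : ContMDiffAt (𝓡 n) 𝓘(ℝ, EuclideanSpace ℝ (Fin n) →L[ℝ] EuclideanSpace ℝ (Fin n)) ∞ f x) :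
    ContMDiffAt (𝓡 n) 𝓘(ℝ, ℝ) ∞ (fun y => (f y).det) x := by
  let b := (EuclideanSpace.basisFun (Fin n) ℝ).toBasis
  have h1 : (fun y => (f y).det) = fun y => ∑ σ : Equiv.Perm (Fin n),
      ((Equiv.Perm.sign σ : ℤ) : ℝ) * ∏ i, (f y (b i)) (σ i) := by
    funext y
    rw [ContinuousLinearMap.det, ← LinearMap.det_toMatrix b, Matrix.det_apply']
    refine Finset.sum_congr rfl fun σ _ => ?_
    congr 1
    refine Finset.prod_congr rfl fun i _ => ?_
    rw [LinearMap.toMatrix_apply]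
    simp [b]
  rw [h1]
  have hentry : ∀ i j, ContMDiffAt (𝓡 n) 𝓘(ℝ, ℝ) ∞ (fun y => (f y (b i)) j) x := by
    intro i j
    let L : (EuclideanSpace ℝ (Fin n) →L[ℝ] EuclideanSpace ℝ (Fin n)) →L[ℝ] ℝ :=
      (EuclideanSpace.proj j).comp (ContinuousLinearMap.apply ℝ _ (b i))
    exact L.contMDiff.contMDiffAt.comp x hf
  refine contMDiffAt_finsetSum fun σ _ => contMDiffAt_const.mul ?_
  exact contMDiffAt_finsetProd fun i _ => hentry i (σ i)

lemma isOpen_target (p : M) : IsOpen (extChartAt (𝓡 n) p).target := isOpen_extChartAt_target p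

variable [IsManifold (𝓡 n) ∞ M]

/-- The coefficient `η(∂₁, …, ∂ₙ)` of a form of top degree in the chart around `p`. -/
def formCoord (p : M) (η : ∀ x : M, TopForm n x) (x : M) : ℝ :=
  η x fun i => (tangentTriv n p).symmₗ ℝ x (EuclideanSpace.single i 1)

lemma tangentTriv_baseSet (p : M) :
    (tangentTriv n p).baseSet = (chartAt (EuclideanSpace ℝ (Fin n)) p).source :=
  TangentBundle.trivializationAt_baseSet p

lemma coordBasis_apply (p x : M) (hx : x ∈ (tangentTriv n p).baseSet) (i : Fin n) :
    coordBasis p x hx i = (tangentTriv n p).symmₗ ℝ x (EuclideanSpace.single i 1) := by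
  rw [coordBasis, Module.Basis.map_apply, OrthonormalBasis.coe_toBasis,
    EuclideanSpace.basisFun_apply, Trivialization.symmₗ_apply _ hx]
  rfl

lemma formCoord_eq (p x : M) (hx : x ∈ (tangentTriv n p).baseSet) (η : ∀ x : M, TopForm n x) :
    formCoord p η x = η x (coordBasis p x hx) := by
  rw [formCoord]
  congr 1
  funext i
  rw [coordBasis_apply]

lemma formCoord_eq_zero_iff (p x : M) (hx : x ∈ (tangentTriv n p).baseSet)
    (η : ∀ x : M, TopForm n x) : formCoord p η x = 0 ↔ η x = 0 := by
  rw [formCoord_eq p x hx, AlternatingMap.map_basis_eq_zero_iff]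

lemma symmₗ_coordChangeL (q p x : M) (hq : x ∈ (tangentTriv n q).baseSet)
    (hp : x ∈ (tangentTriv n p).baseSet) (v : EuclideanSpace ℝ (Fin n)) :
    (tangentTriv n p).symmₗ ℝ x ((tangentTriv n q).coordChangeL ℝ (tangentTriv n p) x v) =
      (tangentTriv n q).symmₗ ℝ x v := by
  rw [Trivialization.coe_coordChangeL _ _ ⟨hq, hp⟩, LinearEquiv.trans_apply,
    Trivialization.symmₗ_apply _ hp, Trivialization.symmₗ_apply _ hq]
  exact ((tangentTriv n p).linearEquivAt ℝ x hp).symm_apply_apply _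

variable (n) in
/-- The Jacobian determinant of the change from the chart around `q` to the chart around `p`. -/
def jacobian (q p x : M) : ℝ :=
  ((tangentTriv n q).coordChangeL ℝ (tangentTriv n p) x :
    EuclideanSpace ℝ (Fin n) →L[ℝ] EuclideanSpace ℝ (Fin n)).det

lemma formCoord_eq_jacobian_mul (q p x : M) (hq : x ∈ (tangentTriv n q).baseSet)
    (hp : x ∈ (tangentTriv n p).baseSet) (η : ∀ x : M, TopForm n x) :
    formCoord q η x = jacobian n q p x * formCoord p η x := by
  set ζ : EuclideanSpace ℝ (Fin n) [⋀^Fin n]→ₗ[ℝ] ℝ :=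
    (η x).compLinearMap ((tangentTriv n p).symmₗ ℝ x) with hζ
  let b := (EuclideanSpace.basisFun (Fin n) ℝ).toBasis
  let A : EuclideanSpace ℝ (Fin n) →ₗ[ℝ] EuclideanSpace ℝ (Fin n) :=
    ((tangentTriv n q).coordChangeL ℝ (tangentTriv n p) x :
      EuclideanSpace ℝ (Fin n) →L[ℝ] EuclideanSpace ℝ (Fin n))
  have hb : ∀ i, b i = EuclideanSpace.single i 1 := fun i => by simp [b]
  have h1 : formCoord p η x = ζ b := by
    rw [formCoord, hζ, AlternatingMap.compLinearMap_apply]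
    simp [hb]
  have h2 : formCoord q η x = ζ (A ∘ b) := by
    rw [formCoord, hζ, AlternatingMap.compLinearMap_apply]
    congr 1
    funext i
    rw [Function.comp_apply, hb]
    exact (symmₗ_coordChangeL q p x hq hp _).symm
  have h3 : ζ (A ∘ b) = LinearMap.det A * ζ b := by
    rw [AlternatingMap.eq_smul_basis_det b ζ]
    simp only [AlternatingMap.smul_apply, Module.Basis.det_comp, Module.Basis.det_self, smul_eq_mul]
    ring
  rw [h1, h2, h3]
  rfl

lemma chartSign_eq_one_or (o : ManifoldOrientation n M) (p x : M)
    (hx : x ∈ (tangentTriv n p).baseSet) :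
    chartSign o.orient p x = 1 ∨ chartSign o.orient p x = -1 := by
  rw [chartSign, dif_pos hx]
  split_ifs <;> simp

lemma chartSign_mul_self (o : ManifoldOrientation n M) (p x : M)
    (hx : x ∈ (tangentTriv n p).baseSet) :
    chartSign o.orient p x * chartSign o.orient p x = 1 := by
  rcases chartSign_eq_one_or o p x hx with h | h <;> rw [h] <;> norm_num

/-- The sign that the orientation assigns to a chart changes by the sign of the Jacobian. -/
lemma chartSign_mul_jacobian (o : ManifoldOrientation n M) (q p x : M)
    (hq : x ∈ (tangentTriv n q).baseSet) (hp : x ∈ (tangentTriv n p).baseSet) :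
    chartSign o.orient q x * jacobian n q p x = |jacobian n q p x| * chartSign o.orient p x := by
  have hdet : jacobian n q p x = (coordBasis p x hp).det (coordBasis q x hq) := by
    classical
    -- the change of coordinates applied to a form with value `dx₁ ∧ … ∧ dxₙ` at `x`
    let η : ∀ y : M, TopForm n y := Function.update (fun _ => 0) x (coordBasis p x hp).det
    have hη : η x = (coordBasis p x hp).det := Function.update_self _ _ _
    have := formCoord_eq_jacobian_mul q p x hq hp η
    rw [formCoord_eq q x hq, formCoord_eq p x hp, hη, Module.Basis.det_self, mul_one] at this
    exact this.symm
  have hne : jacobian n q p x ≠ 0 := by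
    rw [hdet]
    exact ((coordBasis p x hp).isUnit_det _).ne_zero
  have hiff := (coordBasis p x hp).orientation_eq_iff_det_pos (coordBasis q x hq)
  rw [← hdet] at hiff
  rw [chartSign, dif_pos hq, chartSign, dif_pos hp]
  rcases lt_or_gt_of_ne hne with h | h
  · rw [abs_of_neg h]
    have h1 : (coordBasis p x hp).orientation ≠ (coordBasis q x hq).orientation :=
      fun h2 => lt_asymm h (hiff.1 h2)
    have h2 := ((coordBasis q x hq).orientation_ne_iff_eq_neg _).1 h1
    by_cases h3 : (coordBasis q x hq).orientation = o.orient x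
    · rw [if_pos h3, if_neg (by rw [← h3]; exact h1)]; ring
    · have h4 := ((coordBasis q x hq).orientation_ne_iff_eq_neg _).1 (Ne.symm h3)
      rw [if_neg h3, if_pos (by rw [h2, h4])]; ring
  · rw [abs_of_pos h, hiff.2 h]
    ring

lemma chartSign_mul_formCoord (o : ManifoldOrientation n M) (q p x : M)
    (hq : x ∈ (tangentTriv n q).baseSet) (hp : x ∈ (tangentTriv n p).baseSet)
    (η : ∀ x : M, TopForm n x) :
    chartSign o.orient q x * formCoord q η x =
      |jacobian n q p x| * (chartSign o.orient p x * formCoord p η x) := by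
  rw [formCoord_eq_jacobian_mul q p x hq hp, ← mul_assoc, chartSign_mul_jacobian o q p x hq hp,
    mul_assoc]

/-- The tangent bundle of a `C^∞` manifold is `C^∞`, as `∞ + 1 = ∞`. -/
instance : ContMDiffVectorBundle ∞ (EuclideanSpace ℝ (Fin n))
    (TangentSpace (𝓡 n) : M → Type _) (𝓡 n) := by
  have : IsManifold (𝓡 n) (∞ + 1) M := by
    have h : (∞ + 1 : WithTop ℕ∞) = ∞ := rfl
    rw [h]; infer_instance
  infer_instance

lemma contMDiffAt_jacobian (q p x : M) (hq : x ∈ (tangentTriv n q).baseSet)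
    (hp : x ∈ (tangentTriv n p).baseSet) :
    ContMDiffAt (𝓡 n) 𝓘(ℝ, ℝ) ∞ (jacobian n q p) x :=
  contMDiffAt_det (contMDiffAt_coordChangeL hq hp)

/-- Smooth forms of top degree on `M`. -/
def IsSmoothForm (η : ∀ x : M, TopForm n x) : Prop :=
  ∀ p x : M, x ∈ (tangentTriv n p).baseSet → ContMDiffAt (𝓡 n) 𝓘(ℝ, ℝ) ∞ (formCoord p η) x

lemma baseSet_mem_nhds {p x : M} (hx : x ∈ (tangentTriv n p).baseSet) :
    (tangentTriv n p).baseSet ∈ 𝓝 x := (tangentTriv n p).open_baseSet.mem_nhds hx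

/-- For the smoothness of a form at a point, one chart suffices. -/
lemma isSmoothForm_of_exists {η : ∀ x : M, TopForm n x}
    (h : ∀ x : M, ∃ p, x ∈ (tangentTriv n p).baseSet ∧
      ContMDiffAt (𝓡 n) 𝓘(ℝ, ℝ) ∞ (formCoord p η) x) : IsSmoothForm η := by
  intro q x hq
  obtain ⟨p, hp, hs⟩ := h x
  refine ((contMDiffAt_jacobian q p x hq hp).mul hs).congr_of_eventuallyEq ?_
  filter_upwards [baseSet_mem_nhds hq, baseSet_mem_nhds hp] with y hyq hyp
  exact formCoord_eq_jacobian_mul q p y hyq hyp η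

lemma isSmoothForm_zero : IsSmoothForm (0 : ∀ x : M, TopForm n x) :=
  fun _ _ _ => contMDiffAt_const (c := (0 : ℝ))

lemma IsSmoothForm.add {η ζ : ∀ x : M, TopForm n x} (hη : IsSmoothForm η) (hζ : IsSmoothForm ζ) :
    IsSmoothForm (η + ζ) := fun p x hx => (hη p x hx).add (hζ p x hx)

lemma IsSmoothForm.sum {κ : Type*} (s : Finset κ) {η : κ → ∀ x : M, TopForm n x}
    (hη : ∀ i ∈ s, IsSmoothForm (η i)) : IsSmoothForm (∑ i ∈ s, η i) := by
  classical
  induction s using Finset.induction_on with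
  | empty => exact isSmoothForm_zero
  | insert i s hi ih =>
    rw [Finset.sum_insert hi]
    exact (hη i (Finset.mem_insert_self _ _)).add
      (ih fun j hj => hη j (Finset.mem_insert_of_mem hj))

lemma IsSmoothForm.smul {η : ∀ x : M, TopForm n x} (hη : IsSmoothForm η) {h : M → ℝ}
    (hh : ContMDiff (𝓡 n) 𝓘(ℝ, ℝ) ∞ h) : IsSmoothForm (fun x => h x • η x) :=
  fun p x hx => (hh x).mul (hη p x hx)

lemma eventually_chartSign_eq (o : ManifoldOrientation n M) {p x : M}
    (hx : x ∈ (tangentTriv n p).baseSet) :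
    chartSign o.orient p =ᶠ[𝓝 x] fun _ => chartSign o.orient p x := o.locallyConst p x hx

lemma contMDiffAt_chartSign (o : ManifoldOrientation n M) {p x : M}
    (hx : x ∈ (tangentTriv n p).baseSet) :
    ContMDiffAt (𝓡 n) 𝓘(ℝ, ℝ) ∞ (chartSign o.orient p) x :=
  contMDiffAt_const.congr_of_eventuallyEq (eventually_chartSign_eq o hx)

variable (n) in
/-- The form `dx₁ ∧ … ∧ dxₙ` of the chart around `p`, extended by zero. -/
def chartVol (p x : M) : TopForm n x :=
  open Classical in
  if hx : x ∈ (tangentTriv n p).baseSet then (coordBasis p x hx).det else 0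

lemma formCoord_chartVol {p x : M} (hx : x ∈ (tangentTriv n p).baseSet) :
    formCoord p (chartVol n p) x = 1 := by
  rw [formCoord_eq p x hx, chartVol, dif_pos hx, Module.Basis.det_self]

/-! ### The integral in charts -/

variable (n) in
/-- The integral of a function on `M` against Lebesgue measure in the chart around `p`. -/
def chartIntegral (p : M) (G : M → ℝ) : ℝ :=
  ∫ y in (extChartAt (𝓡 n) p).target, G ((extChartAt (𝓡 n) p).symm y)

lemma mem_baseSet_iff {p x : M} :
    x ∈ (tangentTriv n p).baseSet ↔ x ∈ (extChartAt (𝓡 n) p).source := by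
  rw [tangentTriv_baseSet, extChartAt_source]

lemma symm_mem_baseSet {p : M} {y : EuclideanSpace ℝ (Fin n)}
    (hy : y ∈ (extChartAt (𝓡 n) p).target) :
    (extChartAt (𝓡 n) p).symm y ∈ (tangentTriv n p).baseSet :=
  mem_baseSet_iff.2 ((extChartAt (𝓡 n) p).map_target hy)

/-- The coordinate expression of a function with compact support in the domain of a chart is
integrable. -/
lemma integrableOn_chart [CompactSpace M] {p : M} {G : M → ℝ} {K : Set M} (hK : IsClosed K)
    (hKp : K ⊆ (tangentTriv n p).baseSet) (hG : ContinuousOn G (tangentTriv n p).baseSet)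
    (h0 : ∀ x ∉ K, G x = 0) :
    IntegrableOn (fun y => G ((extChartAt (𝓡 n) p).symm y)) (extChartAt (𝓡 n) p).target := by
  have hKs : K ⊆ (extChartAt (𝓡 n) p).source := fun x hx => mem_baseSet_iff.1 (hKp hx)
  have hc : IsCompact (extChartAt (𝓡 n) p '' K) :=
    hK.isCompact.image_of_continuousOn ((continuousOn_extChartAt p).mono hKs)
  have hsub : extChartAt (𝓡 n) p '' K ⊆ (extChartAt (𝓡 n) p).target := by
    rintro _ ⟨x, hx, rfl⟩
    exact (extChartAt (𝓡 n) p).map_source (hKs hx)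
  have hcont : ContinuousOn (fun y => G ((extChartAt (𝓡 n) p).symm y))
      (extChartAt (𝓡 n) p).target :=
    hG.comp (continuousOn_extChartAt_symm p) fun y hy => symm_mem_baseSet hy
  refine ((hcont.mono hsub).integrableOn_compact hc).of_forall_sdiff_eq_zero
    (isOpen_target (n := n) p).measurableSet ?_
  rintro y ⟨hy, hy'⟩
  refine h0 _ fun hx => hy' ⟨_, hx, (extChartAt (𝓡 n) p).right_inv hy⟩

/-- Change of variables between two charts. -/
lemma chartIntegral_eq (o : ManifoldOrientation n M) (q p : M) (η : ∀ x : M, TopForm n x)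
    {g : M → ℝ} (hq : ∀ x ∉ (tangentTriv n q).baseSet, g x = 0)
    (hp : ∀ x ∉ (tangentTriv n p).baseSet, g x = 0) :
    chartIntegral n q (fun x => g x * (chartSign o.orient q x * formCoord q η x)) =
      chartIntegral n p (fun x => g x * (chartSign o.orient p x * formCoord p η x)) := by
  let cq := chartAt (EuclideanSpace ℝ (Fin n)) q
  let cp := chartAt (EuclideanSpace ℝ (Fin n)) p
  let τ : OpenPartialHomeomorph (EuclideanSpace ℝ (Fin n)) (EuclideanSpace ℝ (Fin n)) :=
    cq.symm.trans cp
  have hq1 : ∀ y, (extChartAt (𝓡 n) q).symm y = cq.symm y := fun y => by simp [cq]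
  have hp1 : ∀ y, (extChartAt (𝓡 n) p).symm y = cp.symm y := fun y => by simp [cp]
  have hq2 : (extChartAt (𝓡 n) q).target = cq.target := by simp [cq]
  have hp2 : (extChartAt (𝓡 n) p).target = cp.target := by simp [cp]
  have hτs : τ.source = cq.target ∩ cq.symm ⁻¹' cp.source := by
    simp [τ]
  have hτt : τ.target = cp.target ∩ cp.symm ⁻¹' cq.source := by
    simp [τ]
  have hderiv : ∀ y ∈ τ.source, HasFDerivAt τ ((tangentTriv n q).coordChangeL ℝ (tangentTriv n p)
      (cq.symm y) : EuclideanSpace ℝ (Fin n) →L[ℝ] EuclideanSpace ℝ (Fin n)) y := by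
    intro y hy
    rw [hτs] at hy
    have hyq : cq.symm y ∈ cq.source := cq.map_target hy.1
    have h1 := hasFDerivWithinAt_tangentCoordChange (I := 𝓡 n) (x := q) (y := p) (z := cq.symm y)
      ⟨by rw [extChartAt_source]; exact hyq, by rw [extChartAt_source]; exact hy.2⟩
    have h2 : extChartAt (𝓡 n) q (cq.symm y) = y := by
      have := cq.right_inv hy.1
      simpa [cq] using this
    rw [h2] at h1
    have h3 : ((tangentTriv n q).coordChangeL ℝ (tangentTriv n p) (cq.symm y) :
        EuclideanSpace ℝ (Fin n) →L[ℝ] EuclideanSpace ℝ (Fin n)) =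
        tangentCoordChange (𝓡 n) q p (cq.symm y) := by
      ext1 v
      exact (tangentBundleCore (𝓡 n) M).localTriv_coordChange_eq _ _ ⟨hyq, hy.2⟩ v
    rw [h3]
    have h4 : Set.range (𝓡 n) = Set.univ := by simp
    rw [h4, hasFDerivWithinAt_univ] at h1
    refine h1.congr_of_eventuallyEq (Filter.Eventually.of_forall fun z => ?_)
    simp [τ, cq, cp]
  have key := integral_target_eq_integral_abs_det_fderiv_smul volume (f := τ) hderiv
    (fun z => g (cp.symm z) * (chartSign o.orient p (cp.symm z) * formCoord p η (cp.symm z)))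
  have hL : chartIntegral n q (fun x => g x * (chartSign o.orient q x * formCoord q η x)) =
      ∫ y in τ.source, g (cq.symm y) *
        (chartSign o.orient q (cq.symm y) * formCoord q η (cq.symm y)) := by
    rw [chartIntegral, hq2]
    simp only [hq1]
    refine setIntegral_eq_of_subset_of_forall_sdiff_eq_zero cq.open_target.measurableSet ?_ ?_
    · rw [hτs]; exact Set.inter_subset_left
    · rintro y ⟨hy, hy'⟩
      rw [hp _ fun hx => hy' (by
        rw [hτs]; exact ⟨hy, by rwa [tangentTriv_baseSet] at hx⟩), zero_mul]
  have hR : chartIntegral n p (fun x => g x * (chartSign o.orient p x * formCoord p η x)) =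
      ∫ y in τ.target, g (cp.symm y) *
        (chartSign o.orient p (cp.symm y) * formCoord p η (cp.symm y)) := by
    rw [chartIntegral, hp2]
    simp only [hp1]
    refine setIntegral_eq_of_subset_of_forall_sdiff_eq_zero cp.open_target.measurableSet ?_ ?_
    · rw [hτt]; exact Set.inter_subset_left
    · rintro y ⟨hy, hy'⟩
      rw [hq _ fun hx => hy' (by
        rw [hτt]; exact ⟨hy, by rwa [tangentTriv_baseSet] at hx⟩), zero_mul]
  rw [hL, hR, key]
  refine setIntegral_congr_fun τ.open_source.measurableSet fun y hy => ?_
  have hy2 := hy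
  rw [hτs] at hy2
  have hyq : cq.symm y ∈ cq.source := cq.map_target hy2.1
  have h5 : cp.symm (τ y) = cq.symm y := by
    simp only [τ, OpenPartialHomeomorph.coe_trans, Function.comp_apply]
    exact cp.left_inv hy2.2
  simp only [h5, smul_eq_mul]
  rw [chartSign_mul_formCoord o q p (cq.symm y) (by rw [tangentTriv_baseSet]; exact hyq)
    (by rw [tangentTriv_baseSet]; exact hy2.2)]
  simp only [jacobian]
  ring

end Forms

/-! ### The integral of forms -/

section Integral

open Bundle MeasureTheory

variable {n : ℕ} {M : Type*} [TopologicalSpace M] [ChartedSpace (EuclideanSpace ℝ (Fin n)) M]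

section Partition

variable [CompactSpace M]

/-- A smooth partition of unity on a compact manifold has only finitely many nonzero members. -/
lemma finite_support_nonempty (f : SmoothPartitionOfUnity M (𝓡 n) M Set.univ) :
    {q | (Function.support (f q)).Nonempty}.Finite :=
  f.locallyFinite.finite_nonempty_of_compact

/-- The indices of the nonzero members of a smooth partition of unity on a compact manifold. -/
def indices (f : SmoothPartitionOfUnity M (𝓡 n) M Set.univ) : Finset M :=
  (finite_support_nonempty f).toFinset

lemma apply_eq_zero_of_notMem_indices {f : SmoothPartitionOfUnity M (𝓡 n) M Set.univ} {q : M}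
    (hq : q ∉ indices f) (x : M) : f q x = 0 := by
  by_contra h
  exact hq ((finite_support_nonempty f).mem_toFinset.2 ⟨x, h⟩)

lemma sum_indices (f : SmoothPartitionOfUnity M (𝓡 n) M Set.univ) (x : M) :
    ∑ q ∈ indices f, f q x = 1 := by
  rw [← f.sum_eq_one (Set.mem_univ x)]
  refine (finsum_eq_sum_of_support_subset _ fun q hq => ?_).symm
  by_contra h
  exact hq (apply_eq_zero_of_notMem_indices h x)

end Partition

variable [IsManifold (𝓡 n) ∞ M]

lemma continuousOn_baseSet {p : M} {G : M → ℝ}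
    (h : ∀ x ∈ (tangentTriv n p).baseSet, ContMDiffAt (𝓡 n) 𝓘(ℝ, ℝ) ∞ G x) :
    ContinuousOn G (tangentTriv n p).baseSet :=
  fun x hx => (h x hx).continuousAt.continuousWithinAt

lemma formCoord_eq_zero {p x : M} {η : ∀ x : M, TopForm n x} (h : η x = 0) :
    formCoord p η x = 0 := by
  rw [formCoord, h]; rfl

lemma contMDiffAt_chartSign_mul_formCoord (o : ManifoldOrientation n M) {η : ∀ x : M, TopForm n x}
    (hη : IsSmoothForm η) {p x : M} (hx : x ∈ (tangentTriv n p).baseSet) :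
    ContMDiffAt (𝓡 n) 𝓘(ℝ, ℝ) ∞ (fun x => chartSign o.orient p x * formCoord p η x) x :=
  (contMDiffAt_chartSign o hx).mul (hη p x hx)

variable [T2Space M]

/-- A smooth function with compact support in the image of a chart defines a smooth function
on `M`. -/
lemma contMDiff_indicator_comp_extChartAt {p : M} {g : EuclideanSpace ℝ (Fin n) → ℝ}
    (hg : ContDiff ℝ ∞ g) (hc : HasCompactSupport g)
    (hs : tsupport g ⊆ (extChartAt (𝓡 n) p).target) :
    ContMDiff (𝓡 n) 𝓘(ℝ, ℝ) ∞
      ((extChartAt (𝓡 n) p).source.indicator (g ∘ extChartAt (𝓡 n) p)) := by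
  intro x
  by_cases hx : x ∈ (extChartAt (𝓡 n) p).source
  · have h1 : ContMDiffAt (𝓡 n) 𝓘(ℝ, ℝ) ∞ (g ∘ extChartAt (𝓡 n) p) x :=
      hg.contMDiff.contMDiffAt.comp x (contMDiffAt_extChartAt' (by rwa [← extChartAt_source (𝓡 n)]))
    refine h1.congr_of_eventuallyEq ?_
    filter_upwards [(isOpen_extChartAt_source (I := 𝓡 n) p).mem_nhds hx] with y hy
    rw [Set.indicator_of_mem hy]
  · have hK : IsCompact ((extChartAt (𝓡 n) p).symm '' tsupport g) :=
      hc.isCompact.image_of_continuousOn ((continuousOn_extChartAt_symm p).mono hs)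
    have hxK : x ∉ (extChartAt (𝓡 n) p).symm '' tsupport g := by
      rintro ⟨y, hy, rfl⟩
      exact hx ((extChartAt (𝓡 n) p).map_target (hs hy))
    refine (contMDiffAt_const (c := (0 : ℝ))).congr_of_eventuallyEq ?_
    filter_upwards [hK.isClosed.isOpen_compl.mem_nhds hxK] with y hy
    by_cases hys : y ∈ (extChartAt (𝓡 n) p).source
    · rw [Set.indicator_of_mem hys]
      refine image_eq_zero_of_notMem_tsupport (f := g) fun h => hy ?_
      exact ⟨_, h, (extChartAt (𝓡 n) p).left_inv hys⟩
    · rw [Set.indicator_of_notMem hys]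

variable [CompactSpace M]

lemma tsupport_chartPartition_subset (p : M) :
    tsupport (chartPartition n M p) ⊆ (tangentTriv n p).baseSet := by
  rw [tangentTriv_baseSet]
  exact (SmoothPartitionOfUnity.exists_isSubordinate_chartAt_source (𝓡 n) M).choose_spec p

lemma chartPartition_eq_zero {p x : M} (hx : x ∉ (tangentTriv n p).baseSet) :
    chartPartition n M p x = 0 :=
  image_eq_zero_of_notMem_tsupport fun h => hx (tsupport_chartPartition_subset p h)

lemma formIntegral_eq_sum (o : ManifoldOrientation n M) (η : ∀ x : M, TopForm n x) :
    formIntegral o η = ∑ q ∈ indices (chartPartition n M), chartIntegral n q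
      (fun x => chartPartition n M q x * (chartSign o.orient q x * formCoord q η x)) := by
  refine finsum_eq_sum_of_support_subset (f := fun q => chartIntegral n q
      (fun x => chartPartition n M q x * (chartSign o.orient q x * formCoord q η x))) fun q hq => ?_
  by_contra h
  refine hq ?_
  simp only [apply_eq_zero_of_notMem_indices h, zero_mul]
  simp [chartIntegral]

lemma integrableOn_chartPartition_mul (o : ManifoldOrientation n M) {η : ∀ x : M, TopForm n x}
    (hη : IsSmoothForm η) (q : M) :
    IntegrableOn (fun y => (fun x => chartPartition n M q x *
      (chartSign o.orient q x * formCoord q η x)) ((extChartAt (𝓡 n) q).symm y))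
      (extChartAt (𝓡 n) q).target := by
  refine integrableOn_chart (G := fun x => chartPartition n M q x *
      (chartSign o.orient q x * formCoord q η x)) (isClosed_tsupport (chartPartition n M q))
    (tsupport_chartPartition_subset q)
    (continuousOn_baseSet fun x hx => ((chartPartition n M q).contMDiff x).mul
      (contMDiffAt_chartSign_mul_formCoord o hη hx)) fun x hx => ?_
  rw [image_eq_zero_of_notMem_tsupport hx, zero_mul]

lemma formIntegral_add (o : ManifoldOrientation n M) {η ζ : ∀ x : M, TopForm n x}
    (hη : IsSmoothForm η) (hζ : IsSmoothForm ζ) :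
    formIntegral o (η + ζ) = formIntegral o η + formIntegral o ζ := by
  simp only [formIntegral_eq_sum, ← Finset.sum_add_distrib]
  refine Finset.sum_congr rfl fun q _ => ?_
  simp only [chartIntegral]
  rw [← integral_add (integrableOn_chartPartition_mul o hη q)
    (integrableOn_chartPartition_mul o hζ q)]
  congr 1
  funext y
  have : ∀ x, formCoord q (η + ζ) x = formCoord q η x + formCoord q ζ x := fun x => rfl
  rw [this]
  ring

lemma formIntegral_smul (o : ManifoldOrientation n M) (c : ℝ) (η : ∀ x : M, TopForm n x) :
    formIntegral o (c • η) = c * formIntegral o η := by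
  simp only [formIntegral_eq_sum, Finset.mul_sum]
  refine Finset.sum_congr rfl fun q _ => ?_
  simp only [chartIntegral]
  rw [← integral_const_mul]
  congr 1
  funext y
  have : ∀ x, formCoord q (c • η) x = c * formCoord q η x := fun x => rfl
  rw [this]
  ring

lemma formIntegral_sum (o : ManifoldOrientation n M) {κ : Type*} (s : Finset κ)
    {η : κ → ∀ x : M, TopForm n x} (hη : ∀ i ∈ s, IsSmoothForm (η i)) :
    formIntegral o (∑ i ∈ s, η i) = ∑ i ∈ s, formIntegral o (η i) := by
  classical
  induction s using Finset.induction_on with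
  | empty =>
    have := formIntegral_smul o 0 (0 : ∀ x : M, TopForm n x)
    rwa [smul_zero, zero_mul] at this
  | insert i s hi ih =>
    have hs := fun j hj => hη j (Finset.mem_insert_of_mem hj)
    rw [Finset.sum_insert hi, Finset.sum_insert hi,
      formIntegral_add o (hη i (Finset.mem_insert_self _ _)) (IsSmoothForm.sum s hs), ih hs]

/-- The integral of a form supported in the domain of a chart can be computed in that chart. -/
theorem formIntegral_eq_chartIntegral (o : ManifoldOrientation n M) {η : ∀ x : M, TopForm n x}
    (hη : IsSmoothForm η) {p : M} {K : Set M} (hK : IsClosed K)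
    (hKp : K ⊆ (tangentTriv n p).baseSet) (h0 : ∀ x ∉ K, η x = 0) :
    formIntegral o η = chartIntegral n p (fun x => chartSign o.orient p x * formCoord p η x) := by
  classical
  rw [formIntegral_eq_sum]
  -- `g` cuts off outside `K`, so that the terms vanish outside both chart domains.
  let g : M → M → ℝ := fun q x => if x ∈ K then chartPartition n M q x else 0
  have hg : ∀ r q x, chartPartition n M q x * (chartSign o.orient r x * formCoord r η x) =
      g q x * (chartSign o.orient r x * formCoord r η x) := by
    intro r q x
    by_cases hx : x ∈ K
    · simp [g, hx]
    · rw [formCoord_eq_zero (h0 x hx)]; simp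
  have h1 : ∀ q, chartIntegral n q (fun x => chartPartition n M q x *
      (chartSign o.orient q x * formCoord q η x)) = chartIntegral n p (fun x =>
      chartPartition n M q x * (chartSign o.orient p x * formCoord p η x)) := by
    intro q
    simp only [hg]
    refine chartIntegral_eq o q p η ?_ ?_
    · intro x hx
      simp only [g, chartPartition_eq_zero hx, ite_self]
    · intro x hx
      exact if_neg fun h => hx (hKp h)
  simp only [h1]
  simp only [chartIntegral]
  rw [← integral_finsetSum]
  · congr 1
    funext y
    rw [← Finset.sum_mul, sum_indices, one_mul]
  · intro q _
    refine integrableOn_chart (G := fun x => chartPartition n M q x *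
      (chartSign o.orient p x * formCoord p η x)) hK hKp
      (continuousOn_baseSet fun x hx => ((chartPartition n M q).contMDiff x).mul
      (contMDiffAt_chartSign_mul_formCoord o hη hx)) fun x hx => ?_
    rw [formCoord_eq_zero (h0 x hx), mul_zero, mul_zero]

/-- Smooth cut-off functions that are `1` near a given closed set. -/
lemma exists_bump {K U : Set M} (hK : IsClosed K) (hU : IsOpen U) (hKU : K ⊆ U) :
    ∃ φ : C^∞⟮𝓡 n, M; ℝ⟯, (∀ x ∈ K, ∀ᶠ y in 𝓝 x, φ y = 1) ∧ tsupport φ ⊆ U := by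
  obtain ⟨φ, h0, h1, -⟩ := exists_contMDiffMap_zero_one_nhds_of_isClosed (𝓡 n) (n := (⊤ : ℕ∞))
    hU.isClosed_compl hK (Set.disjoint_compl_left_iff_subset.2 hKU)
  refine ⟨φ, fun x hx => Filter.eventually_iff_exists_mem.2 ?_, fun x hx => ?_⟩
  · exact ⟨_, Filter.mem_of_superset (mem_nhdsSet_iff_forall.1 h1 x hx) fun _ h => h, fun _ h => h⟩
  · by_contra hxU
    exact notMem_tsupport_iff_eventuallyEq.2 (mem_nhdsSet_iff_forall.1 h0 x hxU) hx

/-- The fundamental lemma of the calculus of variations on `M`. -/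
theorem eq_zero_of_forall_formIntegral_smul_eq_zero (o : ManifoldOrientation n M)
    {η : ∀ x : M, TopForm n x} (hη : IsSmoothForm η)
    (h : ∀ k : C^∞⟮𝓡 n, M; ℝ⟯, formIntegral o (fun x => k x • η x) = 0) : η = 0 := by
  funext p
  have hpp : p ∈ (tangentTriv n p).baseSet := mem_baseSet_iff.2 (mem_extChartAt_source p)
  let ψ := extChartAt (𝓡 n) p
  let G : M → ℝ := fun x => chartSign o.orient p x * formCoord p η x
  have hGc : ContinuousOn (fun y => G (ψ.symm y)) ψ.target :=
    (continuousOn_baseSet fun x hx => contMDiffAt_chartSign_mul_formCoord o hη hx).comp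
      (continuousOn_extChartAt_symm p) fun y hy => symm_mem_baseSet hy
  have hae : ∀ᵐ y ∂volume, y ∈ ψ.target → G (ψ.symm y) = 0 := by
    refine (isOpen_target p).ae_eq_zero_of_integral_contDiff_smul_eq_zero
      (hGc.locallyIntegrableOn (isOpen_target p).measurableSet) fun g hg hc hs => ?_
    let k : C^∞⟮𝓡 n, M; ℝ⟯ := ⟨_, contMDiff_indicator_comp_extChartAt hg hc hs⟩
    have hk : ∀ y ∈ ψ.target, k (ψ.symm y) = g y := by
      intro y hy
      change Set.indicator _ _ _ = _
      rw [Set.indicator_of_mem (ψ.map_target hy), Function.comp_apply, ψ.right_inv hy]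
    have hK : IsCompact (ψ.symm '' tsupport g) :=
      hc.isCompact.image_of_continuousOn ((continuousOn_extChartAt_symm p).mono hs)
    have h1 := formIntegral_eq_chartIntegral o (hη.smul k.contMDiff) (p := p) hK.isClosed
      (by rintro _ ⟨y, hy, rfl⟩; exact symm_mem_baseSet (hs hy)) (fun x hx => by
        have : k x = 0 := by
          change Set.indicator _ _ _ = _
          by_cases hxs : x ∈ ψ.source
          · rw [Set.indicator_of_mem hxs]
            exact image_eq_zero_of_notMem_tsupport (f := g) fun h => hx ⟨_, h, ψ.left_inv hxs⟩
          · rw [Set.indicator_of_notMem hxs]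
        rw [this, zero_smul])
    rw [h k] at h1
    rw [h1, chartIntegral, ← setIntegral_eq_integral_of_forall_compl_eq_zero (s := ψ.target)]
    · refine setIntegral_congr_fun (isOpen_target p).measurableSet fun y hy => ?_
      have h2 : formCoord p (fun x => k x • η x) (ψ.symm y) =
        k (ψ.symm y) * formCoord p η (ψ.symm y) := rfl
      simp only [smul_eq_mul, G]
      change _ = chartSign o.orient p (ψ.symm y) * _
      rw [h2, hk y hy]
      ring
    · intro y hy
      rw [image_eq_zero_of_notMem_tsupport fun h => hy (hs h), zero_smul]
  have hzero := Measure.eqOn_open_of_ae_eq (μ := volume) (f := fun y => G (ψ.symm y)) (g := 0)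
    ((ae_restrict_iff' (isOpen_target p).measurableSet).2 hae) (isOpen_target p) hGc
    continuousOn_const
  have h3 := hzero (mem_extChartAt_target p)
  simp only [ψ, extChartAt_to_inv, Pi.zero_apply] at h3
  refine (formCoord_eq_zero_iff p p hpp η).1 ((mul_eq_zero.1 h3).resolve_left ?_)
  rcases chartSign_eq_one_or o p p hpp with h | h <;> rw [h] <;> norm_num

end Integral

/-! ### Hadamard's lemma -/

section Hadamard

open MeasureTheory

variable {V : Type*} [NormedAddCommGroup V] [NormedSpace ℝ V]

/-- A parametric integral over `[0, 1]` of a smooth function is smooth. -/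
lemma contDiff_integral_unitInterval {k : V × ℝ → ℝ} (hk : ContDiff ℝ ∞ k) :
    ContDiff ℝ ∞ (fun p => ∫ t in (0 : ℝ)..1, k (p, t)) := by
  -- The integral is the value at `0` of the convolution of the indicator function of `[0, 1]` with
  -- `s ↦ χ s * k (p, -s)`, where the bump function `χ` makes the support compact.
  let χ : ContDiffBump (0 : ℝ) := ⟨1, 2, one_pos, one_lt_two⟩
  let f : ℝ → ℝ := (Set.Ioc (0 : ℝ) 1).indicator fun _ => 1
  let g : V → ℝ → ℝ := fun p s => χ s * k (p, -s)
  have hf : LocallyIntegrable f volume :=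
    ((integrableOn_const (C := (1 : ℝ)) (by simp)).integrable_indicator
      measurableSet_Ioc).locallyIntegrable
  have hg : ContDiff ℝ ∞ (Function.uncurry g) :=
    (χ.contDiff.comp contDiff_snd).mul (hk.comp (contDiff_fst.prodMk contDiff_snd.neg))
  have h := contDiffOn_convolution_right_with_param_comp (n := ⊤) (μ := volume)
    (ContinuousLinearMap.mul ℝ ℝ) (s := Set.univ) (v := fun _ : V => (0 : ℝ)) contDiffOn_const
    (f := f) (g := g) isOpen_univ (isCompact_closedBall (0 : ℝ) 2) (fun p x _ hx => by
      have : χ x = 0 := χ.zero_of_le_dist (by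
        rw [Metric.mem_closedBall, not_le] at hx; exact hx.le)
      simp [g, this]) hf hg.contDiffOn
  rw [contDiffOn_univ] at h
  convert h using 2 with p
  rw [MeasureTheory.convolution_def, intervalIntegral.integral_of_le zero_le_one,
    ← integral_indicator measurableSet_Ioc]
  congr 1
  funext t
  by_cases ht : t ∈ Set.Ioc (0 : ℝ) 1
  · have : χ (0 - t) = 1 := χ.one_of_mem_closedBall (by
      rw [mem_closedBall_zero_iff, zero_sub, norm_neg, Real.norm_of_nonneg ht.1.le]; exact ht.2)
    rw [zero_sub] at this
    simp [f, g, ht, this]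
  · simp [f, ht]

/-- Hadamard's lemma. -/
theorem exists_hadamard {n : ℕ} {H : EuclideanSpace ℝ (Fin n) → ℝ} (hH : ContDiff ℝ ∞ H)
    (y₀ : EuclideanSpace ℝ (Fin n)) : ∃ g : Fin n → EuclideanSpace ℝ (Fin n) → ℝ,
      (∀ i, ContDiff ℝ ∞ (g i)) ∧ (∀ i, g i y₀ = fderiv ℝ H y₀ (EuclideanSpace.single i 1)) ∧
      ∀ y, H y = H y₀ + ∑ i, (y i - y₀ i) * g i y := by
  have hH' : ContDiff ℝ ∞ (fderiv ℝ H) := hH.fderiv_right (m := ∞) (by rfl)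
  have hline : ContDiff ℝ ∞
      (fun z : EuclideanSpace ℝ (Fin n) × ℝ => y₀ + z.2 • (z.1 - y₀)) :=
    contDiff_const.add (contDiff_snd.smul (contDiff_fst.sub contDiff_const))
  have hk : ∀ v, ContDiff ℝ ∞
      (fun z : EuclideanSpace ℝ (Fin n) × ℝ => fderiv ℝ H (y₀ + z.2 • (z.1 - y₀)) v) :=
    fun v => (hH'.comp hline).clm_apply contDiff_const
  refine ⟨fun i y => ∫ t in (0 : ℝ)..1, fderiv ℝ H (y₀ + t • (y - y₀))
    (EuclideanSpace.single i 1), fun i => contDiff_integral_unitInterval (hk _), fun i => ?_,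
    fun y => ?_⟩
  · simp
  · have hcont : ∀ v, Continuous (fun t : ℝ => fderiv ℝ H (y₀ + t • (y - y₀)) v) := fun v =>
      (hk v).continuous.comp (continuous_const.prodMk continuous_id)
    have h1 : ∀ t ∈ Set.uIcc (0 : ℝ) 1, HasDerivAt (fun t : ℝ => H (y₀ + t • (y - y₀)))
        (fderiv ℝ H (y₀ + t • (y - y₀)) (y - y₀)) t := by
      intro t _
      have h2 : HasDerivAt (fun t : ℝ => y₀ + t • (y - y₀)) (y - y₀) t := by
        simpa using ((hasDerivAt_id t).smul_const (y - y₀)).const_add y₀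
      exact ((hH.differentiable (by simp)).differentiableAt.hasFDerivAt).comp_hasDerivAt t h2
    have h3 := intervalIntegral.integral_eq_sub_of_hasDerivAt h1 ((hcont _).intervalIntegrable _ _)
    simp only [one_smul, add_sub_cancel, zero_smul, add_zero] at h3
    rw [← sub_eq_iff_eq_add', ← h3]
    simp only [← intervalIntegral.integral_const_mul]
    rw [← intervalIntegral.integral_finsetSum fun i _ =>
      ((hcont _).const_mul _ |>.intervalIntegrable _ _)]
    congr 1
    funext t
    have h4 : y - y₀ = ∑ i, (y i - y₀ i) • EuclideanSpace.single i (1 : ℝ) := by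
      have := (EuclideanSpace.basisFun (Fin n) ℝ).sum_repr (y - y₀)
      simpa using this.symm
    refine (congrArg (fderiv ℝ H (y₀ + t • (y - y₀))) h4).trans ?_
    rw [map_sum]
    simp only [map_smul, smul_eq_mul]

end Hadamard

/-! ### Derivations of the algebra of smooth functions on `M` -/

section Derivations

open Bundle MeasureTheory

variable {n : ℕ} {M : Type*} [TopologicalSpace M] [ChartedSpace (EuclideanSpace ℝ (Fin n)) M]
  [IsManifold (𝓡 n) ∞ M]

lemma contDiffAt_comp_extChartAt_symm {h : M → ℝ} {q : M}
    (hh : ∀ x ∈ (tangentTriv n q).baseSet, ContMDiffAt (𝓡 n) 𝓘(ℝ, ℝ) ∞ h x)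
    {y : EuclideanSpace ℝ (Fin n)} (hy : y ∈ (extChartAt (𝓡 n) q).target) :
    ContDiffAt ℝ ∞ (h ∘ (extChartAt (𝓡 n) q).symm) y := by
  rw [← contMDiffAt_iff_contDiffAt]
  exact (hh _ (symm_mem_baseSet hy)).comp y
    ((contMDiffOn_extChartAt_symm q).contMDiffAt ((isOpen_target q).mem_nhds hy))

variable [T2Space M] [CompactSpace M]

/-- Point derivations are local. -/
lemma derivation_eq_zero_of_eventuallyEq {x₀ : M} {D : C^∞⟮𝓡 n, M; ℝ⟯ →ₗ[ℝ] ℝ}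
    (hD : ∀ h k, D (h * k) = h x₀ * D k + k x₀ * D h) {k : C^∞⟮𝓡 n, M; ℝ⟯}
    (hk : ∀ᶠ x in 𝓝 x₀, k x = 0) : D k = 0 := by
  obtain ⟨U, hU, hUo, hxU⟩ := eventually_nhds_iff.1 hk
  obtain ⟨χ, h1, h2⟩ := exists_bump (n := n) (isClosed_singleton (x := x₀)) hUo
    (Set.singleton_subset_iff.2 hxU)
  have h3 : χ * k = 0 := by
    ext x
    by_cases hx : x ∈ U
    · exact mul_eq_zero_of_right (χ x) (hU x hx)
    · exact mul_eq_zero_of_left (image_eq_zero_of_notMem_tsupport fun h => hx (h2 h)) (k x)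
  have h4 := hD χ k
  rw [h3, map_zero, (h1 x₀ rfl).self_of_nhds, hk.self_of_nhds, zero_mul, add_zero, one_mul] at h4
  exact h4.symm

/-- A point derivation is a combination of the partial derivatives in a chart. -/
theorem derivation_eq_sum {x₀ q : M} (hx₀ : x₀ ∈ (tangentTriv n q).baseSet)
    {D : C^∞⟮𝓡 n, M; ℝ⟯ →ₗ[ℝ] ℝ} (hD : ∀ h k, D (h * k) = h x₀ * D k + k x₀ * D h)
    {Y : Fin n → C^∞⟮𝓡 n, M; ℝ⟯} (hY : ∀ i, ∀ᶠ x in 𝓝 x₀, Y i x = extChartAt (𝓡 n) q x i)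
    (h : C^∞⟮𝓡 n, M; ℝ⟯) :
    D h = ∑ i, fderiv ℝ (h ∘ (extChartAt (𝓡 n) q).symm) (extChartAt (𝓡 n) q x₀)
      (EuclideanSpace.single i 1) * D (Y i) := by
  set ψ := extChartAt (𝓡 n) q with hψ
  have hx₀s : x₀ ∈ ψ.source := mem_baseSet_iff.1 hx₀
  set y₀ := ψ x₀ with hy₀
  obtain ⟨r, hr, hrt⟩ := Metric.nhds_basis_closedBall.mem_iff.1
    ((isOpen_target q).mem_nhds (ψ.map_source hx₀s))
  let χ : ContDiffBump y₀ := ⟨r / 2, r, half_pos hr, half_lt_self hr⟩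
  have hχt : tsupport χ ⊆ ψ.target := by rw [χ.tsupport_eq]; exact hrt
  have hχ1 : ∀ᶠ y in 𝓝 y₀, χ y = 1 := χ.eventuallyEq_one
  let H : EuclideanSpace ℝ (Fin n) → ℝ := fun y => χ y * h (ψ.symm y)
  have hH : ContDiff ℝ ∞ H := by
    rw [contDiff_iff_contDiffAt]
    intro y
    by_cases hy : y ∈ ψ.target
    · exact χ.contDiff.contDiffAt.mul
        (contDiffAt_comp_extChartAt_symm (fun x _ => h.contMDiff x) hy)
    · refine (contDiffAt_const (c := (0 : ℝ))).congr_of_eventuallyEq ?_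
      filter_upwards [notMem_tsupport_iff_eventuallyEq.1 fun h => hy (hχt h)] with z hz
      simp [H, hz]
  obtain ⟨g, hg, hg0, hHg⟩ := exists_hadamard hH y₀
  have hfd : fderiv ℝ H y₀ = fderiv ℝ (h ∘ ψ.symm) y₀ := by
    refine Filter.EventuallyEq.fderiv_eq ?_
    filter_upwards [hχ1] with y hy
    simp [H, hy]
  let G : Fin n → C^∞⟮𝓡 n, M; ℝ⟯ := fun i => ⟨_, contMDiff_indicator_comp_extChartAt (p := q)
    (g := fun y => χ y * g i y) (χ.contDiff.mul (hg i)) (χ.hasCompactSupport.mul_right)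
    ((tsupport_mul_subset_left).trans hχt)⟩
  have hG : ∀ i, ∀ x ∈ ψ.source, G i x = χ (ψ x) * g i (ψ x) := fun i x hx =>
    Set.indicator_of_mem hx _
  have hG0 : ∀ i, G i x₀ = g i y₀ := by
    intro i
    rw [hG i x₀ hx₀s, ← hy₀, hχ1.self_of_nhds, one_mul]
  have h1 : D 1 = 0 := by
    have := hD 1 1
    rw [mul_one] at this
    have h2 : (1 : C^∞⟮𝓡 n, M; ℝ⟯) x₀ = 1 := rfl
    rw [h2] at this
    linarith
  have hy₀i : ∀ i, Y i x₀ = y₀ i := fun i => (hY i).self_of_nhds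
  -- Hadamard's lemma for `H`, which is the coordinate expression of `h` near `x₀`
  have hloc : D (h - (h x₀ • 1 + ∑ i, (Y i - y₀ i • 1) * G i)) = 0 := by
    refine derivation_eq_zero_of_eventuallyEq hD ?_
    filter_upwards [(continuousAt_extChartAt' hx₀s).eventually hχ1,
      (isOpen_extChartAt_source (I := 𝓡 n) q).mem_nhds hx₀s,
      Filter.eventually_all.2 hY] with x hx1 hxs hxY
    have h5 := hHg (ψ x)
    have h6 : H (ψ x) = h x := by
      simp only [H]
      rw [hx1, one_mul, ψ.left_inv hxs]
    have h7 : H y₀ = h x₀ := by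
      simp only [H]
      rw [hχ1.self_of_nhds, one_mul, ψ.left_inv hx₀s]
    rw [h6, h7] at h5
    have h8 : (h - (h x₀ • 1 + ∑ i, (Y i - y₀ i • 1) * G i)) x =
        h x - (h x₀ * 1 + ∑ i, (Y i x - y₀ i * 1) * G i x) := by
      have h9 : (∑ i, (Y i - y₀ i • 1) * G i : C^∞⟮𝓡 n, M; ℝ⟯) x =
          ∑ i, (Y i x - y₀ i * 1) * G i x := by
        rw [← ContMDiffMap.coeFnAddMonoidHom_apply, map_sum, Finset.sum_apply]
        rfl
      rw [← h9]; rfl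
    rw [h8, h5, mul_one, sub_eq_zero]
    congr 1
    refine Finset.sum_congr rfl fun i _ => ?_
    rw [hxY i, hG i x hxs, hx1]
    ring
  rw [map_sub, map_add, map_smul, h1, smul_zero, zero_add, map_sum, sub_eq_zero] at hloc
  rw [hloc]
  refine Finset.sum_congr rfl fun i _ => ?_
  have h10 : (Y i - y₀ i • 1 : C^∞⟮𝓡 n, M; ℝ⟯) x₀ = 0 := by
    have : (Y i - y₀ i • 1 : C^∞⟮𝓡 n, M; ℝ⟯) x₀ = Y i x₀ - y₀ i * 1 := rfl
    rw [this, hy₀i, mul_one, sub_self]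
  rw [hD, h10, zero_mul, zero_add, map_sub, map_smul, h1, smul_zero, sub_zero, hG0, hg0, hfd]

lemma integrable_of_continuousOn {U K : Set (EuclideanSpace ℝ (Fin n))}
    {f : EuclideanSpace ℝ (Fin n) → ℝ} (hK : IsCompact K) (hKU : K ⊆ U) (hf : ContinuousOn f U)
    (h0 : ∀ y ∉ K, f y = 0) : Integrable f :=
  (integrableOn_iff_integrable_of_support_subset fun y hy => by
    by_contra h; exact hy (h0 y h)).1 ((hf.mono hKU).integrableOn_compact hK)

/-- The contribution of one chart to the divergence of a derivation `δ`. There `ρ_q δ h` is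
`∑ aᵢ ∂ᵢh` with coefficients `aᵢ` of compact support, and the integral is `-∫ h ∑ ∂ᵢaᵢ`. -/
lemma exists_chart_divergence (o : ManifoldOrientation n M)
    {δ : C^∞⟮𝓡 n, M; ℝ⟯ →ₗ[ℝ] (∀ x : M, TopForm n x)} (hs : ∀ h, IsSmoothForm (δ h))
    (hl : ∀ h k x, δ (h * k) x = h x • δ k x + k x • δ h x) (q : M) :
    ∃ β : ∀ x : M, TopForm n x, IsSmoothForm β ∧ ∀ h : C^∞⟮𝓡 n, M; ℝ⟯, chartIntegral n q
      (fun x => chartPartition n M q x * (chartSign o.orient q x * formCoord q (δ h) x)) =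
      - formIntegral o (fun x => h x • β x) := by
  set ψ := extChartAt (𝓡 n) q with hψ
  set K := tsupport (chartPartition n M q) with hKdef
  have hK : IsClosed K := isClosed_tsupport _
  have hKq : K ⊆ (tangentTriv n q).baseSet := tsupport_chartPartition_subset q
  have hKs : K ⊆ ψ.source := fun x hx => mem_baseSet_iff.1 (hKq hx)
  have hKc : IsCompact (ψ '' K) :=
    hK.isCompact.image_of_continuousOn ((continuousOn_extChartAt q).mono hKs)
  have hKt : ψ '' K ⊆ ψ.target := by
    rintro _ ⟨x, hx, rfl⟩
    exact ψ.map_source (hKs hx)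
  obtain ⟨φ, hφ1, hφs⟩ := exists_bump (n := n) hK (tangentTriv n q).open_baseSet hKq
  let Y : Fin n → C^∞⟮𝓡 n, M; ℝ⟯ := fun i => ⟨fun x => φ x * ψ x i, fun x => by
    by_cases hx : x ∈ (tangentTriv n q).baseSet
    · refine (φ.contMDiff x).mul ?_
      have h1 : ContMDiffAt (𝓡 n) 𝓘(ℝ, EuclideanSpace ℝ (Fin n)) ∞ ψ x :=
        contMDiffAt_extChartAt' (by rwa [← tangentTriv_baseSet])
      exact (EuclideanSpace.proj (𝕜 := ℝ) i).contMDiff.contMDiffAt.comp x h1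
    · refine (contMDiffAt_const (c := (0 : ℝ))).congr_of_eventuallyEq ?_
      filter_upwards [notMem_tsupport_iff_eventuallyEq.1 fun h => hx (hφs h)] with z hz
      rw [hz]; exact zero_mul _⟩
  have hY : ∀ x ∈ K, ∀ i, ∀ᶠ z in 𝓝 x, Y i z = ψ z i := by
    intro x hx i
    filter_upwards [hφ1 x hx] with z hz
    change φ z * ψ z i = _
    rw [hz, one_mul]
  -- the components of the vector field in the chart, multiplied by the density and cut off
  let A : Fin n → M → ℝ := fun i x =>
    chartPartition n M q x * (chartSign o.orient q x * formCoord q (δ (Y i)) x)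
  have hA0 : ∀ i, ∀ x ∉ K, A i x = 0 := by
    intro i x hx
    simp only [A]
    rw [image_eq_zero_of_notMem_tsupport hx, zero_mul]
  have hAs : ∀ i, ∀ x ∈ (tangentTriv n q).baseSet, ContMDiffAt (𝓡 n) 𝓘(ℝ, ℝ) ∞ (A i) x :=
    fun i x hx => ((chartPartition n M q).contMDiff x).mul
      (contMDiffAt_chartSign_mul_formCoord o (hs _) hx)
  let a : Fin n → EuclideanSpace ℝ (Fin n) → ℝ := fun i => ψ.target.indicator (A i ∘ ψ.symm)
  have ha0 : ∀ i, ∀ y ∉ ψ '' K, a i y = 0 := by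
    intro i y hy
    by_cases hyt : y ∈ ψ.target
    · simp only [a]
      rw [Set.indicator_of_mem hyt]
      exact hA0 i _ fun h => hy ⟨_, h, ψ.right_inv hyt⟩
    · exact Set.indicator_of_notMem hyt _
  have ha0' : ∀ i, ∀ y ∉ ψ '' K, a i =ᶠ[𝓝 y] fun _ => 0 := by
    intro i y hy
    filter_upwards [hKc.isClosed.isOpen_compl.mem_nhds hy] with z hz using ha0 i z hz
  have has : ∀ i, ContDiff ℝ ∞ (a i) := by
    intro i
    rw [contDiff_iff_contDiffAt]
    intro y
    by_cases hy : y ∈ ψ.target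
    · refine (contDiffAt_comp_extChartAt_symm (hAs i) hy).congr_of_eventuallyEq ?_
      filter_upwards [(isOpen_target q).mem_nhds hy] with z hz
      exact Set.indicator_of_mem hz _
    · exact (contDiffAt_const (c := (0 : ℝ))).congr_of_eventuallyEq
        (ha0' i y fun h => hy (hKt h))
  have hats : ∀ i, tsupport (a i) ⊆ ψ '' K := by
    intro i
    refine closure_minimal (fun y hy => ?_) hKc.isClosed
    by_contra h
    exact hy (ha0 i y h)
  let b' : Fin n → EuclideanSpace ℝ (Fin n) → ℝ := fun i y =>
    fderiv ℝ (a i) y (EuclideanSpace.single i 1)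
  have hb's : ∀ i, ContDiff ℝ ∞ (b' i) := fun i =>
    ((has i).fderiv_right (m := ∞) (by rfl)).clm_apply contDiff_const
  have hb'0 : ∀ i, ∀ y ∉ ψ '' K, b' i y = 0 := by
    intro i y hy
    simp only [b']
    rw [(ha0' i y hy).fderiv_eq]
    simp
  let b : EuclideanSpace ℝ (Fin n) → ℝ := fun y => ∑ i, b' i y
  have hbs : ContDiff ℝ ∞ b := ContDiff.sum fun i _ => hb's i
  have hb0 : ∀ y ∉ ψ '' K, b y = 0 := fun y hy => Finset.sum_eq_zero fun i _ => hb'0 i y hy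
  let β : ∀ x : M, TopForm n x := fun x => (chartSign o.orient q x * b (ψ x)) • chartVol n q x
  have hβ0 : ∀ x ∉ K, β x = 0 := by
    intro x hx
    by_cases hxq : x ∈ (tangentTriv n q).baseSet
    · have : b (ψ x) = 0 := hb0 _ fun ⟨z, hz, hzx⟩ => hx (by
        rwa [← ψ.injOn (hKs hz) (mem_baseSet_iff.1 hxq) hzx])
      simp only [β, this, mul_zero, zero_smul]
    · simp only [β, chartVol, dif_neg hxq, smul_zero]
  have hβc : ∀ x ∈ (tangentTriv n q).baseSet,
      formCoord q β x = chartSign o.orient q x * b (ψ x) := by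
    intro x hx
    have : formCoord q β x = (chartSign o.orient q x * b (ψ x)) * formCoord q (chartVol n q) x :=
      rfl
    rw [this, formCoord_chartVol hx, mul_one]
  have hβs : IsSmoothForm β := by
    refine isSmoothForm_of_exists fun x => ?_
    by_cases hx : x ∈ (tangentTriv n q).baseSet
    · refine ⟨q, hx, ?_⟩
      have h1 : ContMDiffAt (𝓡 n) 𝓘(ℝ, ℝ) ∞ (b ∘ ψ) x := hbs.contMDiff.contMDiffAt.comp x
        (contMDiffAt_extChartAt' (by rwa [← tangentTriv_baseSet]))
      refine ((contMDiffAt_chartSign o hx).mul h1).congr_of_eventuallyEq ?_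
      filter_upwards [baseSet_mem_nhds hx] with z hz using hβc z hz
    · refine ⟨x, mem_baseSet_iff.2 (mem_extChartAt_source x),
        (contMDiffAt_const (c := (0 : ℝ))).congr_of_eventuallyEq ?_⟩
      filter_upwards [hK.isOpen_compl.mem_nhds fun h => hx (hKq h)] with z hz
      exact formCoord_eq_zero (hβ0 z hz)
  refine ⟨β, hβs, fun h => ?_⟩
  have hhs : ∀ y ∈ ψ.target, ContDiffAt ℝ ∞ (h ∘ ψ.symm) y := fun y hy =>
    contDiffAt_comp_extChartAt_symm (fun x _ => h.contMDiff x) hy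
  have hhc : ContinuousOn (h ∘ ψ.symm) ψ.target := fun y hy =>
    (hhs y hy).continuousAt.continuousWithinAt
  have hhd : ∀ v, ContinuousOn (fun y => fderiv ℝ (h ∘ ψ.symm) y v) ψ.target := fun v y hy =>
    (((hhs y hy).fderiv_right (m := 0) (by simp)).continuousAt.clm_apply
      continuousAt_const).continuousWithinAt
  have hleft : chartIntegral n q (fun x => chartPartition n M q x *
      (chartSign o.orient q x * formCoord q (δ h) x)) = ∫ y in ψ.target,
        ∑ i, fderiv ℝ (h ∘ ψ.symm) y (EuclideanSpace.single i 1) * a i y := by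
    refine setIntegral_congr_fun (isOpen_target q).measurableSet fun y hy => ?_
    set x := ψ.symm y with hx
    have hyx : ψ x = y := ψ.right_inv hy
    have ha : ∀ i, a i y = A i x := fun i => Set.indicator_of_mem hy _
    simp only [ha]
    by_cases hxK : x ∈ K
    · let D : C^∞⟮𝓡 n, M; ℝ⟯ →ₗ[ℝ] ℝ :=
        { toFun := fun k => formCoord q (δ k) x
          map_add' := fun k l => by rw [map_add]; rfl
          map_smul' := fun c k => by rw [map_smul]; rfl }
      have hD := derivation_eq_sum (D := D) (hKq hxK) (fun k l => by
        change formCoord q (δ (k * l)) x = k x * formCoord q (δ l) x + l x * formCoord q (δ k) x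
        simp only [formCoord]
        rw [hl]
        rfl) (hY x hxK) h
      change chartPartition n M q x * (chartSign o.orient q x * D h) = _
      rw [hD, Finset.mul_sum, Finset.mul_sum, ← hψ, hyx]
      refine Finset.sum_congr rfl fun i _ => ?_
      change _ = _ * (chartPartition n M q x * (chartSign o.orient q x * D (Y i)))
      ring
    · rw [image_eq_zero_of_notMem_tsupport hxK, zero_mul]
      simp only [hA0 _ x hxK, mul_zero, Finset.sum_const_zero]
  have hright : formIntegral o (fun x => h x • β x) = ∫ y in ψ.target, (h ∘ ψ.symm) y * b y := by
    rw [formIntegral_eq_chartIntegral o (hβs.smul h.contMDiff) hK hKq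
      fun x hx => by rw [hβ0 x hx, smul_zero]]
    refine setIntegral_congr_fun (isOpen_target q).measurableSet fun y hy => ?_
    have h1 : formCoord q (fun x => h x • β x) (ψ.symm y) =
      h (ψ.symm y) * formCoord q β (ψ.symm y) := rfl
    change chartSign o.orient q (ψ.symm y) * _ = _
    rw [h1, hβc _ (symm_mem_baseSet hy), ψ.right_inv hy, Function.comp_apply]
    have := chartSign_mul_self o q _ (symm_mem_baseSet hy)
    linear_combination (h (ψ.symm y) * b y) * this
  rw [hleft, hright, setIntegral_eq_integral_of_forall_compl_eq_zero fun y hy =>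
      Finset.sum_eq_zero fun i _ => by rw [ha0 i y fun h => hy (hKt h), mul_zero],
    setIntegral_eq_integral_of_forall_compl_eq_zero fun y hy => by
      rw [hb0 y fun h => hy (hKt h), mul_zero]]
  have hint1 : ∀ i, Integrable fun y =>
      fderiv ℝ (h ∘ ψ.symm) y (EuclideanSpace.single i 1) * a i y := fun i =>
    integrable_of_continuousOn hKc hKt ((hhd _).mul (has i).continuous.continuousOn)
      fun y hy => by rw [ha0 i y hy, mul_zero]
  have hint2 : ∀ i, Integrable fun y => (h ∘ ψ.symm) y * b' i y := fun i =>
    integrable_of_continuousOn hKc hKt (hhc.mul (hb's i).continuous.continuousOn)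
      fun y hy => by rw [hb'0 i y hy, mul_zero]
  have hint3 : ∀ i, Integrable fun y => (h ∘ ψ.symm) y * a i y := fun i =>
    integrable_of_continuousOn hKc hKt (hhc.mul (has i).continuous.continuousOn)
      fun y hy => by rw [ha0 i y hy, mul_zero]
  rw [integral_finsetSum _ fun i _ => hint1 i]
  simp only [b, Finset.mul_sum]
  rw [integral_finsetSum _ fun i _ => hint2 i, ← Finset.sum_neg_distrib]
  refine Finset.sum_congr rfl fun i _ => ?_
  rw [integral_mul_fderiv_eq_neg_fderiv_mul_of_integrable (hint1 i) (hint2 i) (hint3 i)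
    (fun y hy => (hhs y (hKt (hats i hy))).differentiableAt (by simp))
    (fun y _ => (has i).contDiffAt.differentiableAt (by simp)), neg_neg]

/-- The divergence theorem: a derivation of `C^∞(M)` with values in the forms of top degree is,
under the integral, minus the multiplication with a form of top degree. -/
theorem exists_divergence_form (o : ManifoldOrientation n M)
    {δ : C^∞⟮𝓡 n, M; ℝ⟯ →ₗ[ℝ] (∀ x : M, TopForm n x)} (hs : ∀ h, IsSmoothForm (δ h))
    (hl : ∀ h k x, δ (h * k) x = h x • δ k x + k x • δ h x) :
    ∃ β : ∀ x : M, TopForm n x, IsSmoothForm β ∧ ∀ h : C^∞⟮𝓡 n, M; ℝ⟯,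
      formIntegral o (δ h) = - formIntegral o (fun x => h x • β x) := by
  choose β hβ hβδ using fun q => exists_chart_divergence o hs hl q
  refine ⟨∑ q ∈ indices (chartPartition n M), β q, IsSmoothForm.sum _ fun q _ => hβ q,
    fun h => ?_⟩
  have h1 : (fun x => h x • (∑ q ∈ indices (chartPartition n M), β q) x) =
      ∑ q ∈ indices (chartPartition n M), fun x => h x • β q x := by
    funext x
    rw [Finset.sum_apply, Finset.sum_apply, Finset.smul_sum]
  rw [h1, formIntegral_sum o _ fun q _ => (hβ q).smul h.contMDiff, formIntegral_eq_sum,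
    ← Finset.sum_neg_distrib]
  exact Finset.sum_congr rfl fun q _ => hβδ q h

end Derivations

/-! ### Functions on `E` in local trivializations -/

section Functions

open Bundle
open scoped Matrix

section Coordinates

variable {M : Type*} [TopologicalSpace M] {F : Type*} [TopologicalSpace F] {E : M → Type*}
  [∀ x, TopologicalSpace (E x)] [TopologicalSpace (Bundle.TotalSpace F E)] [FiberBundle F E]

variable (F E) in
/-- The domain of the local trivialization of `E` around `p`. -/
abbrev trivDomain (p : M) : Set M := (trivializationAt F E p).baseSet

lemma trivDomain_mem_nhds {p x : M} (hx : x ∈ trivDomain F E p) : trivDomain F E p ∈ 𝓝 x :=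
  (trivializationAt F E p).open_baseSet.mem_nhds hx

end Coordinates

section Coordinates

variable {M : Type*} [TopologicalSpace M] {F : Type*} [NormedAddCommGroup F] [NormedSpace ℝ F]
  {E : M → Type*} [∀ x, AddCommGroup (E x)] [∀ x, Module ℝ (E x)]
  [∀ x, TopologicalSpace (E x)] [TopologicalSpace (Bundle.TotalSpace F E)]
  [FiberBundle F E] [VectorBundle ℝ F E]

variable (F E) in
/-- The inverse `Λ F* → Λ E_x*` of the coordinate expression in the local trivialization
around `p`. -/
def funCoordInv (p x : M) :
    ExteriorAlgebra ℝ (Module.Dual ℝ F) →ₐ[ℝ] ExteriorAlgebra ℝ (Module.Dual ℝ (E x)) :=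
  ExteriorAlgebra.map ((trivializationAt F E p).linearMapAt ℝ x).dualMap

lemma map_dualMap_map_dualMap {V₁ V₂ V₃ : Type*} [AddCommGroup V₁] [Module ℝ V₁] [AddCommGroup V₂]
    [Module ℝ V₂] [AddCommGroup V₃] [Module ℝ V₃] (φ : V₁ →ₗ[ℝ] V₂) (χ : V₂ →ₗ[ℝ] V₃)
    (w : ExteriorAlgebra ℝ (Module.Dual ℝ V₃)) :
    ExteriorAlgebra.map φ.dualMap (ExteriorAlgebra.map χ.dualMap w) =
      ExteriorAlgebra.map (χ ∘ₗ φ).dualMap w := by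
  rw [← LinearMap.dualMap_comp_dualMap, ← ExteriorAlgebra.map_comp_map]
  rfl

lemma map_dualMap_id {V : Type*} [AddCommGroup V] [Module ℝ V]
    (w : ExteriorAlgebra ℝ (Module.Dual ℝ V)) :
    ExteriorAlgebra.map (LinearMap.id (R := ℝ) (M := V)).dualMap w = w := by
  rw [LinearMap.dualMap_id, ExteriorAlgebra.map_id]
  rfl

lemma funCoord_funCoordInv {p x : M} (hx : x ∈ trivDomain F E p)
    (w : ExteriorAlgebra ℝ (Module.Dual ℝ F)) : funCoord F E p x (funCoordInv F E p x w) = w := by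
  rw [funCoord, funCoordInv, map_dualMap_map_dualMap]
  have : (trivializationAt F E p).linearMapAt ℝ x ∘ₗ (trivializationAt F E p).symmₗ ℝ x =
      LinearMap.id := LinearMap.ext fun v => (trivializationAt F E p).linearMapAt_symmₗ hx v
  rw [this, map_dualMap_id]

lemma symmₗ_comp_linearMapAt {p x : M} (hx : x ∈ trivDomain F E p) :
    (trivializationAt F E p).symmₗ ℝ x ∘ₗ (trivializationAt F E p).linearMapAt ℝ x =
      LinearMap.id := LinearMap.ext fun v => (trivializationAt F E p).symmₗ_linearMapAt hx v

lemma funCoordInv_funCoord {p x : M} (hx : x ∈ trivDomain F E p)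
    (w : ExteriorAlgebra ℝ (Module.Dual ℝ (E x))) :
    funCoordInv F E p x (funCoord F E p x w) = w := by
  rw [funCoord, funCoordInv, map_dualMap_map_dualMap, symmₗ_comp_linearMapAt hx, map_dualMap_id]

lemma funCoord_funCoordInv_eq_map {q p x : M} (hq : x ∈ trivDomain F E q)
    (hp : x ∈ trivDomain F E p) (w : ExteriorAlgebra ℝ (Module.Dual ℝ F)) :
    funCoord F E q x (funCoordInv F E p x w) = ExteriorAlgebra.map
      (((trivializationAt F E q).coordChangeL ℝ (trivializationAt F E p) x : F →L[ℝ] F) :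
        F →ₗ[ℝ] F).dualMap w := by
  rw [funCoord, funCoordInv, map_dualMap_map_dualMap]
  congr 3
  refine LinearMap.ext fun v => ?_
  rw [LinearMap.comp_apply, Trivialization.symmₗ_apply _ hq, Trivialization.linearMapAt_apply,
    if_pos hp]
  exact ((trivializationAt F E q).coordChangeL_apply (trivializationAt F E p) ⟨hq, hp⟩ v).symm

end Coordinates

variable {n : ℕ} {M : Type*} [TopologicalSpace M] [ChartedSpace (EuclideanSpace ℝ (Fin n)) M]

lemma contMDiffAt_of_eventually_eq_zero {f : M → ℝ} {x : M} (h : ∀ᶠ y in 𝓝 x, f y = 0) :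
    ContMDiffAt (𝓡 n) 𝓘(ℝ, ℝ) ∞ f x :=
  (contMDiffAt_const (c := (0 : ℝ))).congr_of_eventuallyEq h

lemma contMDiffAt_matrix_det {κ : Type*} [Fintype κ] [DecidableEq κ] {A : M → Matrix κ κ ℝ} {x : M}
    (hA : ∀ i j, ContMDiffAt (𝓡 n) 𝓘(ℝ, ℝ) ∞ (fun y => A y i j) x) :
    ContMDiffAt (𝓡 n) 𝓘(ℝ, ℝ) ∞ (fun y => (A y).det) x := by
  simp only [Matrix.det_apply']
  exact contMDiffAt_finsetSum fun σ _ => contMDiffAt_const.mul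
    (contMDiffAt_finsetProd fun i _ => hA _ _)

/-- Cramer's rule: the solution of a regular system of linear equations depends smoothly on the
coefficients. -/
lemma contMDiffAt_of_mulVec_eq {κ : Type*} [Fintype κ] [DecidableEq κ] {A : M → Matrix κ κ ℝ}
    {v w : M → κ → ℝ} {x : M} (hA : ∀ i j, ContMDiffAt (𝓡 n) 𝓘(ℝ, ℝ) ∞ (fun y => A y i j) x)
    (hw : ∀ i, ContMDiffAt (𝓡 n) 𝓘(ℝ, ℝ) ∞ (fun y => w y i) x)
    (hdet : ∀ᶠ y in 𝓝 x, (A y).det ≠ 0) (h : ∀ᶠ y in 𝓝 x, A y *ᵥ v y = w y) (i : κ) :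
    ContMDiffAt (𝓡 n) 𝓘(ℝ, ℝ) ∞ (fun y => v y i) x := by
  have hadj : ∀ i j, ContMDiffAt (𝓡 n) 𝓘(ℝ, ℝ) ∞ (fun y => (A y).adjugate i j) x := by
    intro i j
    simp only [Matrix.adjugate_apply]
    refine contMDiffAt_matrix_det fun k l => ?_
    by_cases hk : k = j
    · subst hk
      simp only [Matrix.updateRow_self]
      exact contMDiffAt_const
    · simp only [Matrix.updateRow_ne hk]
      exact hA k l
  have h1 : ContMDiffAt (𝓡 n) 𝓘(ℝ, ℝ) ∞
      (fun y => (A y).det⁻¹ * ∑ j, (A y).adjugate i j * w y j) x :=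
    ((contMDiffAt_matrix_det hA).inv₀ hdet.self_of_nhds).mul
      (contMDiffAt_finsetSum fun j _ => (hadj i j).mul (hw j))
  refine h1.congr_of_eventuallyEq ?_
  filter_upwards [hdet, h] with y hy1 hy2
  have h3 : (A y).adjugate *ᵥ w y = (A y).det • v y := by
    rw [← hy2, Matrix.mulVec_mulVec, Matrix.adjugate_mul, Matrix.smul_mulVec, Matrix.one_mulVec]
  have h4 := congrFun h3 i
  rw [Matrix.mulVec, dotProduct, Pi.smul_apply, smul_eq_mul] at h4
  rw [h4, inv_mul_cancel_left₀ hy1]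

variable (F : Type*) [NormedAddCommGroup F] [NormedSpace ℝ F] [FiniteDimensional ℝ F]

/-- A basis of the finite-dimensional space `Λ F*`. -/
def fiberBasis : Module.Basis (Fin (Module.finrank ℝ (ExteriorAlgebra ℝ (Module.Dual ℝ F)))) ℝ
    (ExteriorAlgebra ℝ (Module.Dual ℝ F)) := Module.finBasis ℝ _

variable {F}

lemma linear_apply_eq_sum {W : Type*} [AddCommGroup W] [Module ℝ W]
    (l : ExteriorAlgebra ℝ (Module.Dual ℝ F) →ₗ[ℝ] W) (v : ExteriorAlgebra ℝ (Module.Dual ℝ F)) :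
    l v = ∑ J, (fiberBasis F).coord J v • l (fiberBasis F J) := by
  conv_lhs => rw [← (fiberBasis F).sum_repr v, map_sum]
  simp only [map_smul, Module.Basis.coord_apply]

/-- A smooth family of linear maps induces a smooth family of maps of the exterior algebras. -/
lemma contMDiffAt_map_dualMap {A : M → F →L[ℝ] F} {x : M}
    (hA : ContMDiffAt (𝓡 n) 𝓘(ℝ, F →L[ℝ] F) ∞ A x)
    (w : ExteriorAlgebra ℝ (Module.Dual ℝ F)) :
    ∀ l : ExteriorAlgebra ℝ (Module.Dual ℝ F) →ₗ[ℝ] ℝ, ContMDiffAt (𝓡 n) 𝓘(ℝ, ℝ) ∞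
      (fun y => l (ExteriorAlgebra.map (A y : F →ₗ[ℝ] F).dualMap w)) x := by
  induction w using ExteriorAlgebra.induction with
  | algebraMap r =>
    intro l
    simp only [AlgHom.commutes]
    exact contMDiffAt_const
  | ι α =>
    intro l
    let L : (F →L[ℝ] F) →ₗ[ℝ] ℝ :=
      { toFun := fun B => l (ExteriorAlgebra.ι ℝ ((B : F →ₗ[ℝ] F).dualMap α))
        map_add' := fun B C => by
          rw [← map_add, ← map_add]
          congr 2
          ext v
          simp
        map_smul' := fun c B => by
          rw [RingHom.id_apply, ← map_smul, ← map_smul]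
          congr 2
          ext v
          simp }
    simp only [ExteriorAlgebra.map_apply_ι]
    exact (LinearMap.toContinuousLinearMap L).contMDiff.contMDiffAt.comp x hA
  | mul u v hu hv =>
    intro l
    have h1 : ∀ y, l (ExteriorAlgebra.map (A y : F →ₗ[ℝ] F).dualMap (u * v)) =
        ∑ I, ∑ J, ((fiberBasis F).coord I (ExteriorAlgebra.map (A y : F →ₗ[ℝ] F).dualMap u) *
          (fiberBasis F).coord J (ExteriorAlgebra.map (A y : F →ₗ[ℝ] F).dualMap v)) *
            l (fiberBasis F I * fiberBasis F J) := by
      intro y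
      rw [map_mul]
      have h2 := linear_apply_eq_sum (l ∘ₗ LinearMap.mulRight ℝ
        (ExteriorAlgebra.map (A y : F →ₗ[ℝ] F).dualMap v))
        (ExteriorAlgebra.map (A y : F →ₗ[ℝ] F).dualMap u)
      simp only [LinearMap.comp_apply, LinearMap.mulRight_apply] at h2
      rw [h2]
      refine Finset.sum_congr rfl fun I _ => ?_
      have h3 := linear_apply_eq_sum (l ∘ₗ LinearMap.mulLeft ℝ (fiberBasis F I))
        (ExteriorAlgebra.map (A y : F →ₗ[ℝ] F).dualMap v)
      simp only [LinearMap.comp_apply, LinearMap.mulLeft_apply] at h3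
      rw [h3, Finset.smul_sum]
      simp only [smul_eq_mul, mul_assoc]
    simp only [h1]
    exact contMDiffAt_finsetSum fun I _ => contMDiffAt_finsetSum fun J _ =>
      ((hu _).mul (hv _)).mul contMDiffAt_const
  | add u v hu hv =>
    intro l
    simp only [map_add]
    exact (hu l).add (hv l)

variable {E : M → Type*} [∀ x, AddCommGroup (E x)] [∀ x, Module ℝ (E x)]
  [∀ x, TopologicalSpace (E x)] [TopologicalSpace (Bundle.TotalSpace F E)]
  [FiberBundle F E] [VectorBundle ℝ F E]

lemma func_contMDiffAt (f : Func n F E) {p x : M} (hx : x ∈ trivDomain F E p)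
    (l : ExteriorAlgebra ℝ (Module.Dual ℝ F) →ₗ[ℝ] ℝ) :
    ContMDiffAt (𝓡 n) 𝓘(ℝ, ℝ) ∞ (fun y => l (funCoord F E p y (f.1 y))) x :=
  (f.2 p l).contMDiffAt (trivDomain_mem_nhds hx)

variable (F E) in
/-- The inclusion of the smooth functions on `M` into the functions on `E`. -/
def ofSmooth : C^∞⟮𝓡 n, M; ℝ⟯ →ₐ[ℝ] Func n F E where
  toFun h := ⟨fun x => algebraMap ℝ _ (h x), fun p l => by
    have : ∀ x, l (funCoord F E p x (algebraMap ℝ _ (h x))) = h x * l 1 := fun x => by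
      rw [AlgHom.commutes, Algebra.algebraMap_eq_smul_one, map_smul, smul_eq_mul]
    simp only [this]
    exact (h.contMDiff.mul contMDiff_const).contMDiffOn⟩
  map_one' := Subtype.ext (funext fun x => map_one _)
  map_mul' h k := Subtype.ext (funext fun x => map_mul (algebraMap ℝ _) (h x) (k x))
  map_zero' := Subtype.ext (funext fun x => map_zero _)
  map_add' h k := Subtype.ext (funext fun x => map_add (algebraMap ℝ _) (h x) (k x))
  commutes' r := rfl

lemma ofSmooth_mul_apply (h : C^∞⟮𝓡 n, M; ℝ⟯) (f : Func n F E) (x : M) :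
    (ofSmooth F E h * f).1 x = h x • f.1 x := (Algebra.smul_def (h x) (f.1 x)).symm

variable [ContMDiffVectorBundle ∞ F E (𝓡 n)]

lemma contMDiffAt_funCoord_funCoordInv {q p x : M} (hq : x ∈ trivDomain F E q)
    (hp : x ∈ trivDomain F E p) (w : ExteriorAlgebra ℝ (Module.Dual ℝ F))
    (l : ExteriorAlgebra ℝ (Module.Dual ℝ F) →ₗ[ℝ] ℝ) : ContMDiffAt (𝓡 n) 𝓘(ℝ, ℝ) ∞
      (fun y => l (funCoord F E q y (funCoordInv F E p y w))) x := by
  refine (contMDiffAt_map_dualMap (contMDiffAt_coordChangeL hq hp) w l).congr_of_eventuallyEq ?_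
  filter_upwards [trivDomain_mem_nhds hq, trivDomain_mem_nhds hp] with y hyq hyp
  rw [funCoord_funCoordInv_eq_map hyq hyp]

/-- For the smoothness of a section of `Λ E*` at a point, one trivialization suffices. -/
lemma mem_func_of_exists {f : ∀ x : M, ExteriorAlgebra ℝ (Module.Dual ℝ (E x))}
    (h : ∀ x, ∃ p, x ∈ trivDomain F E p ∧ ∀ l : ExteriorAlgebra ℝ (Module.Dual ℝ F) →ₗ[ℝ] ℝ,
      ContMDiffAt (𝓡 n) 𝓘(ℝ, ℝ) ∞ (fun y => l (funCoord F E p y (f y))) x) :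
    f ∈ Func n F E := by
  intro q l x hx
  obtain ⟨p, hp, hs⟩ := h x
  have h1 : ContMDiffAt (𝓡 n) 𝓘(ℝ, ℝ) ∞ (fun y => ∑ J,
      (fiberBasis F).coord J (funCoord F E p y (f y)) *
        l (funCoord F E q y (funCoordInv F E p y (fiberBasis F J)))) x :=
    contMDiffAt_finsetSum fun J _ => (hs _).mul (contMDiffAt_funCoord_funCoordInv hx hp _ l)
  refine (h1.congr_of_eventuallyEq ?_).contMDiffWithinAt
  filter_upwards [trivDomain_mem_nhds hp] with y hy
  have h2 := linear_apply_eq_sum (l ∘ₗ (funCoord F E q y).toLinearMap ∘ₗ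
    (funCoordInv F E p y).toLinearMap) (funCoord F E p y (f y))
  simp only [LinearMap.comp_apply, AlgHom.toLinearMap_apply, funCoordInv_funCoord hy,
    smul_eq_mul] at h2
  exact h2

/-- The function on `E` that is constant, equal to `w`, in the local trivialization around `p`,
multiplied by a cut-off function. -/
def extendConst (p : M) (φ : C^∞⟮𝓡 n, M; ℝ⟯) (hφ : tsupport φ ⊆ trivDomain F E p)
    (w : ExteriorAlgebra ℝ (Module.Dual ℝ F)) : Func n F E :=
  ⟨fun x => φ x • funCoordInv F E p x w, mem_func_of_exists fun x => by
    by_cases hx : x ∈ trivDomain F E p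
    · refine ⟨p, hx, fun l => ?_⟩
      refine ((φ.contMDiff x).mul (contMDiffAt_const (c := l w))).congr_of_eventuallyEq ?_
      filter_upwards [trivDomain_mem_nhds hx] with y hy
      rw [map_smul, map_smul, funCoord_funCoordInv hy, smul_eq_mul]
      rfl
    · refine ⟨x, mem_baseSet_trivializationAt F E x, fun l => contMDiffAt_of_eventually_eq_zero ?_⟩
      filter_upwards [notMem_tsupport_iff_eventuallyEq.1 fun h => hx (hφ h)] with y hy
      rw [hy, Pi.zero_apply, zero_smul, map_zero, map_zero]⟩

/-- The coefficient of `f` at a member of the basis of `Λ F*`, multiplied by a cut-off function. -/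
def coefficient (p : M) (φ : C^∞⟮𝓡 n, M; ℝ⟯) (hφ : tsupport φ ⊆ trivDomain F E p)
    (J : Fin (Module.finrank ℝ (ExteriorAlgebra ℝ (Module.Dual ℝ F)))) (f : Func n F E) :
    C^∞⟮𝓡 n, M; ℝ⟯ :=
  ⟨fun x => φ x * (fiberBasis F).coord J (funCoord F E p x (f.1 x)), fun x => by
    by_cases hx : x ∈ trivDomain F E p
    · exact (φ.contMDiff x).mul (func_contMDiffAt f hx _)
    · refine contMDiffAt_of_eventually_eq_zero ?_
      filter_upwards [notMem_tsupport_iff_eventuallyEq.1 fun h => hx (hφ h)] with y hy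
      rw [hy, Pi.zero_apply, zero_mul]⟩

end Functions

/-! ### The pairing with a Berezinian form -/

section Berezinian

lemma finiteDimensional_fiber {M : Type*} [TopologicalSpace M] (F : Type*) [NormedAddCommGroup F]
    [NormedSpace ℝ F] [FiniteDimensional ℝ F] {E : M → Type*} [∀ x, AddCommGroup (E x)]
    [∀ x, Module ℝ (E x)] [∀ x, TopologicalSpace (E x)]
    [TopologicalSpace (Bundle.TotalSpace F E)] [FiberBundle F E] [VectorBundle ℝ F E] (x : M) :
    FiniteDimensional ℝ (E x) :=
  Module.Finite.equiv ((trivializationAt F E x).linearEquivAt ℝ x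
    (mem_baseSet_trivializationAt F E x)).symm

open Bundle
open scoped Matrix

variable {n : ℕ} {M : Type*} [TopologicalSpace M] [ChartedSpace (EuclideanSpace ℝ (Fin n)) M]
  {F : Type*} [NormedAddCommGroup F] [NormedSpace ℝ F]
  {E : M → Type*} [∀ x, AddCommGroup (E x)] [∀ x, Module ℝ (E x)]

/-- The form `⟨c | t⟩` of top degree at a point, as a linear map of `c ∈ Λ E_x*`. -/
def fiberPairing {x : M} (t : BerFiber n E x) :
    ExteriorAlgebra ℝ (Module.Dual ℝ (E x)) →ₗ[ℝ] TopForm n x where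
  toFun c := TensorProduct.lid ℝ (TopForm n x) (TensorProduct.map (pairing (E x) c) LinearMap.id t)
  map_add' c d := by
    rw [map_add, TensorProduct.map_add_left, LinearMap.add_apply, map_add]
  map_smul' r c := by
    rw [map_smul, TensorProduct.map_smul_left, LinearMap.smul_apply, map_smul, RingHom.id_apply]

/-- The evaluation of the second tensor factor of `Λ V ⊗ Λᵗᵒᵖ T*` at `n` tangent vectors. -/
def evalForm {V T : Type*} [AddCommGroup V] [Module ℝ V] [AddCommGroup T] [Module ℝ T] {n : ℕ}
    (v : Fin n → T) : ExteriorAlgebra ℝ V ⊗[ℝ] (T [⋀^Fin n]→ₗ[ℝ] ℝ) →ₗ[ℝ] ExteriorAlgebra ℝ V :=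
  (TensorProduct.rid ℝ _).toLinearMap ∘ₗ TensorProduct.map LinearMap.id
    { toFun := fun η => η v
      map_add' := fun _ _ => rfl
      map_smul' := fun _ _ => rfl }

lemma evalForm_tmul {V T : Type*} [AddCommGroup V] [Module ℝ V] [AddCommGroup T] [Module ℝ T]
    {n : ℕ} (v : Fin n → T) (a : ExteriorAlgebra ℝ V) (η : T [⋀^Fin n]→ₗ[ℝ] ℝ) :
    evalForm v (a ⊗ₜ[ℝ] η) = η v • a := by
  simp [evalForm]

lemma fiberPairing_apply {x : M} (t : BerFiber n E x)
    (c : ExteriorAlgebra ℝ (Module.Dual ℝ (E x))) (v : Fin n → TangentSpace (𝓡 n) x) :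
    fiberPairing t c v = pairing (E x) c (evalForm v t) := by
  change (TensorProduct.lid ℝ (TopForm n x)
    (TensorProduct.map (pairing (E x) c) LinearMap.id t)) v = _
  induction t using TensorProduct.induction_on with
  | zero => simp only [map_zero]; rfl
  | tmul a η =>
    rw [TensorProduct.map_tmul, TensorProduct.lid_tmul, evalForm_tmul, map_smul, smul_eq_mul,
      mul_comm]
    rfl
  | add t s ht hs => simp only [map_add, AlternatingMap.add_apply, ht, hs]

variable [IsManifold (𝓡 n) ∞ M]

/-- The pairing with a Berezinian form is nondegenerate. -/
lemma exists_fiberPairing_mul_ne_zero {x : M} [FiniteDimensional ℝ (E x)] {t : BerFiber n E x}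
    (ht : TensorProduct.map
      (GradedAlgebra.proj (fun i : ℕ => ⋀[ℝ]^i (E x)) (Module.finrank ℝ (E x)))
      (LinearMap.id : TopForm n x →ₗ[ℝ] TopForm n x) t ≠ 0)
    {f : ExteriorAlgebra ℝ (Module.Dual ℝ (E x))} (hf : f ≠ 0) :
    ∃ g, fiberPairing t (g * f) ≠ 0 := by
  let b := coordBasis (n := n) x x (mem_baseSet_iff.2 (mem_extChartAt_source x))
  have hinj : Function.Injective (evalForm (V := E x) b) := by
    refine (TensorProduct.rid ℝ _).injective.comp ?_
    refine Module.Flat.lTensor_preserves_injective_linearMap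
      ({ toFun := fun η => η b, map_add' := fun _ _ => rfl, map_smul' := fun _ _ => rfl } :
        TopForm n x →ₗ[ℝ] ℝ) ?_
    rw [← LinearMap.ker_eq_bot, LinearMap.ker_eq_bot']
    exact fun η hη => (AlternatingMap.map_basis_eq_zero_iff b η).1 hη
  have hproj : ∀ s : BerFiber n E x, GradedAlgebra.proj (fun i : ℕ => ⋀[ℝ]^i (E x))
      (Module.finrank ℝ (E x)) (evalForm b s) = evalForm b (TensorProduct.map
      (GradedAlgebra.proj (fun i : ℕ => ⋀[ℝ]^i (E x)) (Module.finrank ℝ (E x)))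
      (LinearMap.id : TopForm n x →ₗ[ℝ] TopForm n x) s) := by
    intro s
    induction s using TensorProduct.induction_on with
    | zero => simp only [map_zero]
    | tmul a η =>
      rw [TensorProduct.map_tmul, evalForm_tmul, evalForm_tmul, map_smul, LinearMap.id_apply]
    | add t s ht hs => simp only [map_add, ht, hs]
  have hne : GradedAlgebra.proj (fun i : ℕ => ⋀[ℝ]^i (E x)) (Module.finrank ℝ (E x))
      (evalForm b t) ≠ 0 := by
    rw [hproj]
    exact fun h => ht (hinj (h.trans (map_zero _).symm))
  obtain ⟨g, hg⟩ := exists_pairing_mul_ne_zero hne hf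
  refine ⟨g, fun h => hg ?_⟩
  rw [← fiberPairing_apply, h]
  rfl

/-- An element of `BER(E)_x` whose top component does not vanish identifies `Λ E_x*` with its
dual. -/
lemma exists_fiberPairing_mul_eq {x : M} [FiniteDimensional ℝ (E x)] {t : BerFiber n E x}
    (ht : TensorProduct.map
      (GradedAlgebra.proj (fun i : ℕ => ⋀[ℝ]^i (E x)) (Module.finrank ℝ (E x)))
      (LinearMap.id : TopForm n x →ₗ[ℝ] TopForm n x) t ≠ 0)
    (L : ExteriorAlgebra ℝ (Module.Dual ℝ (E x)) →ₗ[ℝ] TopForm n x) :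
    ∃ g, ∀ c, fiberPairing t (c * g) = L c := by
  let b := coordBasis (n := n) x x (mem_baseSet_iff.2 (mem_extChartAt_source x))
  let ev : TopForm n x →ₗ[ℝ] ℝ :=
    { toFun := fun η => η b, map_add' := fun _ _ => rfl, map_smul' := fun _ _ => rfl }
  have hev : ∀ η, ev η = 0 → η = 0 := fun η hη => (AlternatingMap.map_basis_eq_zero_iff b η).1 hη
  let T : ExteriorAlgebra ℝ (Module.Dual ℝ (E x)) →ₗ[ℝ]
      Module.Dual ℝ (ExteriorAlgebra ℝ (Module.Dual ℝ (E x))) :=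
    LinearMap.flip ((LinearMap.mul ℝ _).compr₂ (ev ∘ₗ fiberPairing t))
  have hT : ∀ g c, T g c = ev (fiberPairing t (c * g)) := fun g c => rfl
  have hinj : Function.Injective T := by
    rw [← LinearMap.ker_eq_bot, LinearMap.ker_eq_bot']
    intro g hg
    by_contra hg0
    obtain ⟨c, hc⟩ := exists_fiberPairing_mul_ne_zero ht hg0
    exact hc (hev _ (by rw [← hT, hg]; rfl))
  obtain ⟨g, hg⟩ := (LinearMap.injective_iff_surjective_of_finrank_eq_finrank
    Subspace.dual_finrank_eq.symm).1 hinj (ev ∘ₗ L)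
  refine ⟨g, fun c => ?_⟩
  rw [← sub_eq_zero]
  refine hev _ ?_
  rw [map_sub, ← hT, hg, LinearMap.comp_apply, sub_self]

variable [∀ x, TopologicalSpace (E x)] [TopologicalSpace (Bundle.TotalSpace F E)]
  [FiberBundle F E] [VectorBundle ℝ F E]

/-- The coordinate expression in `Λ F` of an element of `BER(E)_x`. -/
def berVec (p : M) {x : M} (t : BerFiber n E x) : ExteriorAlgebra ℝ F :=
  evalForm (fun i => EuclideanSpace.single i 1) (berCoord F E p x t)

lemma fiberPairing_eq_pairing_berVec {p x : M} (hx : x ∈ trivDomain F E p) (t : BerFiber n E x)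
    (c : ExteriorAlgebra ℝ (Module.Dual ℝ (E x))) :
    (fiberPairing t c fun i => (tangentTriv n p).symmₗ ℝ x (EuclideanSpace.single i 1)) =
      pairing F (funCoord F E p x c) (berVec p t) := by
  rw [fiberPairing_apply, funCoord, ← pairing_map]
  congr 1
  rw [berVec]
  induction t using TensorProduct.induction_on with
  | zero => simp only [map_zero]
  | tmul a η =>
    rw [berCoord, TensorProduct.map_tmul, evalForm_tmul, evalForm_tmul, map_smul]
    congr 1
    rw [AlgHom.toLinearMap_apply, ← AlgHom.comp_apply, ExteriorAlgebra.map_comp_map,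
      symmₗ_comp_linearMapAt hx, ExteriorAlgebra.map_id]
    rfl
  | add t s ht hs => simp only [map_add, ht, hs]

lemma contMDiffAt_pairing_berVec (μ : BerSection n F E) {p x : M} (hx : x ∈ trivDomain F E p)
    (hxp : x ∈ (tangentTriv n p).baseSet) (w : ExteriorAlgebra ℝ (Module.Dual ℝ F)) :
    ContMDiffAt (𝓡 n) 𝓘(ℝ, ℝ) ∞ (fun y => pairing F w (berVec p (μ.1 y))) x :=
  (μ.2 p (pairing F w ∘ₗ evalForm (fun i => EuclideanSpace.single i 1))).contMDiffAt
    (Filter.inter_mem (trivDomain_mem_nhds hx) (baseSet_mem_nhds hxp))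

variable [FiniteDimensional ℝ F]

lemma berPairing_eq (f : Func n F E) (μ : BerSection n F E) (x : M) :
    berPairing f μ x = fiberPairing (μ.1 x) (f.1 x) := rfl

lemma isSmoothForm_berPairing (f : Func n F E) (μ : BerSection n F E) :
    IsSmoothForm (berPairing f μ) := by
  refine isSmoothForm_of_exists fun x => ⟨x, mem_baseSet_iff.2 (mem_extChartAt_source x), ?_⟩
  have hx : x ∈ trivDomain F E x := mem_baseSet_trivializationAt F E x
  have h1 : ContMDiffAt (𝓡 n) 𝓘(ℝ, ℝ) ∞ (fun y => ∑ J,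
      (fiberBasis F).coord J (funCoord F E x y (f.1 y)) *
        pairing F (fiberBasis F J) (berVec x (μ.1 y))) x :=
    contMDiffAt_finsetSum fun J _ => (func_contMDiffAt f hx _).mul
      (contMDiffAt_pairing_berVec μ hx (mem_baseSet_iff.2 (mem_extChartAt_source x)) _)
  refine h1.congr_of_eventuallyEq ?_
  filter_upwards [trivDomain_mem_nhds hx] with y hy
  refine (fiberPairing_eq_pairing_berVec hy (μ.1 y) (f.1 y)).trans ?_
  exact linear_apply_eq_sum ((pairing F).flip (berVec x (μ.1 y))) (funCoord F E x y (f.1 y))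

lemma berPairing_add (f g : Func n F E) (μ : BerSection n F E) :
    berPairing (f + g) μ = berPairing f μ + berPairing g μ :=
  funext fun x => map_add (fiberPairing (μ.1 x)) (f.1 x) (g.1 x)

lemma berPairing_smul (c : ℝ) (f : Func n F E) (μ : BerSection n F E) :
    berPairing (c • f) μ = c • berPairing f μ :=
  funext fun x => map_smul (fiberPairing (μ.1 x)) c (f.1 x)

lemma berPairing_ofSmooth_mul (h : C^∞⟮𝓡 n, M; ℝ⟯) (f : Func n F E) (μ : BerSection n F E) :
    berPairing (ofSmooth F E h * f) μ = fun x => h x • berPairing f μ x := by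
  funext x
  rw [berPairing_eq, ofSmooth_mul_apply, map_smul]
  rfl

lemma berIntegral_add [T2Space M] [CompactSpace M] (o : ManifoldOrientation n M)
    (f g : Func n F E) (μ : BerSection n F E) :
    berIntegral o (f + g) μ = berIntegral o f μ + berIntegral o g μ := by
  rw [berIntegral, berPairing_add, formIntegral_add o (isSmoothForm_berPairing _ _)
    (isSmoothForm_berPairing _ _)]
  rfl

lemma berIntegral_smul [T2Space M] [CompactSpace M] (o : ManifoldOrientation n M)
    (c : ℝ) (f : Func n F E) (μ : BerSection n F E) :
    berIntegral o (c • f) μ = c * berIntegral o f μ := by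
  rw [berIntegral, berPairing_smul, formIntegral_smul]
  rfl

lemma berIntegral_sum [T2Space M] [CompactSpace M] (o : ManifoldOrientation n M) {κ : Type*}
    (s : Finset κ) (f : κ → Func n F E) (μ : BerSection n F E) :
    berIntegral o (∑ i ∈ s, f i) μ = ∑ i ∈ s, berIntegral o (f i) μ := by
  classical
  induction s using Finset.induction_on with
  | empty =>
    have := berIntegral_smul o 0 (0 : Func n F E) μ
    rwa [zero_smul, zero_mul] at this
  | insert i s hi ih => rw [Finset.sum_insert hi, Finset.sum_insert hi, berIntegral_add, ih]

variable [ContMDiffVectorBundle ∞ F E (𝓡 n)]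

/-- Duality: a smooth family of linear maps `Λ E_x* → Λᵗᵒᵖ T_x*M` is the pairing with `g μ` for a
function `g` on `E`. -/
theorem exists_func_berPairing_mul_eq {μ : BerSection n F E} (hμ : IsBerezinianForm μ)
    (L : ∀ x : M, ExteriorAlgebra ℝ (Module.Dual ℝ (E x)) →ₗ[ℝ] TopForm n x)
    (hL : ∀ (x : M) (w : ExteriorAlgebra ℝ (Module.Dual ℝ F)), ContMDiffAt (𝓡 n) 𝓘(ℝ, ℝ) ∞
      (formCoord x fun y => L y (funCoordInv F E x y w)) x) :
    ∃ g : Func n F E, ∀ (f : Func n F E) (x : M), berPairing (f * g) μ x = L x (f.1 x) := by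
  have hfin : ∀ x, FiniteDimensional ℝ (E x) := finiteDimensional_fiber F
  choose g hg using fun x => exists_fiberPairing_mul_eq (hμ x) (L x)
  refine ⟨⟨g, mem_func_of_exists fun x => ⟨x, mem_baseSet_trivializationAt F E x, ?_⟩⟩,
    fun f x => hg x (f.1 x)⟩
  have hx : x ∈ trivDomain F E x := mem_baseSet_trivializationAt F E x
  have hxt : x ∈ (tangentTriv n x).baseSet := mem_baseSet_iff.2 (mem_extChartAt_source x)
  -- the matrix of the pairing in the trivialization around `x`
  let A : M → Matrix (Fin (Module.finrank ℝ (ExteriorAlgebra ℝ (Module.Dual ℝ F))))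
      (Fin (Module.finrank ℝ (ExteriorAlgebra ℝ (Module.Dual ℝ F)))) ℝ :=
    fun y => Matrix.of fun I J => pairing F (fiberBasis F I * fiberBasis F J) (berVec x (μ.1 y))
  have hA : ∀ y ∈ trivDomain F E x, ∀ (a : ExteriorAlgebra ℝ (Module.Dual ℝ (E y))) I,
      (A y *ᵥ fun J => (fiberBasis F).coord J (funCoord F E x y a)) I =
        fiberPairing (μ.1 y) (funCoordInv F E x y (fiberBasis F I) * a) fun i =>
          (tangentTriv n x).symmₗ ℝ y (EuclideanSpace.single i 1) := by
    intro y hy a I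
    rw [fiberPairing_eq_pairing_berVec hy, map_mul, funCoord_funCoordInv hy]
    have := linear_apply_eq_sum ((pairing F).flip (berVec x (μ.1 y)) ∘ₗ
      LinearMap.mulLeft ℝ (fiberBasis F I)) (funCoord F E x y a)
    simp only [LinearMap.comp_apply, LinearMap.mulLeft_apply, LinearMap.flip_apply] at this
    rw [this]
    simp only [Matrix.mulVec, dotProduct, smul_eq_mul]
    exact Finset.sum_congr rfl fun J _ => mul_comm _ _
  have hdet : ∀ y ∈ trivDomain F E x, y ∈ (tangentTriv n x).baseSet → (A y).det ≠ 0 := by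
    intro y hy hyt h0
    obtain ⟨v, hv, hAv⟩ := Matrix.exists_mulVec_eq_zero_iff.2 h0
    let w := ∑ J, v J • fiberBasis F J
    have hw : ∀ J, (fiberBasis F).coord J w = v J := fun J => by
      rw [Module.Basis.coord_apply, (fiberBasis F).repr_sum_self]
    have hw0 : funCoordInv F E x y w ≠ 0 := by
      intro h
      have h1 := funCoord_funCoordInv hy w
      rw [h, map_zero] at h1
      refine hv (funext fun J => ?_)
      rw [← hw J, ← h1, map_zero, Pi.zero_apply]
    obtain ⟨c, hc⟩ := exists_fiberPairing_mul_ne_zero (hμ y) hw0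
    have h2 : ∀ I, fiberPairing (μ.1 y) (funCoordInv F E x y (fiberBasis F I) *
        funCoordInv F E x y w) = 0 := by
      intro I
      have h3 := hA y hy (funCoordInv F E x y w) I
      simp only [funCoord_funCoordInv hy, hw] at h3
      rw [hAv, Pi.zero_apply] at h3
      classical
      -- a form with the given value at `y`, whose coordinate at `y` is known to vanish
      let η : ∀ z : M, TopForm n z := Function.update (fun _ => 0) y
        (fiberPairing (μ.1 y) (funCoordInv F E x y (fiberBasis F I) * funCoordInv F E x y w))
      have hη : η y = _ := Function.update_self _ _ _
      rw [← hη]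
      refine (formCoord_eq_zero_iff x y hyt η).1 ?_
      rw [formCoord, hη]
      exact h3.symm
    refine hc ?_
    have h4 := linear_apply_eq_sum (fiberPairing (μ.1 y) ∘ₗ
      LinearMap.mulRight ℝ (funCoordInv F E x y w) ∘ₗ (funCoordInv F E x y).toLinearMap)
      (funCoord F E x y c)
    simp only [LinearMap.comp_apply, LinearMap.mulRight_apply, AlgHom.toLinearMap_apply,
      funCoordInv_funCoord hy, h2, smul_zero, Finset.sum_const_zero] at h4
    exact h4
  have hcoord : ∀ J, ContMDiffAt (𝓡 n) 𝓘(ℝ, ℝ) ∞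
      (fun y => (fiberBasis F).coord J (funCoord F E x y (g y))) x := by
    refine contMDiffAt_of_mulVec_eq (A := A)
      (w := fun y I => formCoord x (fun y => L y (funCoordInv F E x y (fiberBasis F I))) y)
      (fun I J => contMDiffAt_pairing_berVec μ hx hxt _) (fun I => hL x _) ?_ ?_
    · filter_upwards [trivDomain_mem_nhds hx, baseSet_mem_nhds hxt] with y hy hyt
        using hdet y hy hyt
    · filter_upwards [trivDomain_mem_nhds hx] with y hy
      funext I
      rw [hA y hy, hg]
      rfl
  intro l
  have h1 : ContMDiffAt (𝓡 n) 𝓘(ℝ, ℝ) ∞ (fun y => ∑ J,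
      (fiberBasis F).coord J (funCoord F E x y (g y)) * l (fiberBasis F J)) x :=
    contMDiffAt_finsetSum fun J _ => (hcoord J).mul contMDiffAt_const
  exact h1.congr_of_eventuallyEq (Filter.Eventually.of_forall fun y => linear_apply_eq_sum l _)

/-- The product of a coefficient of `f` and a form is of the shape `⟨f g | μ⟩`. -/
lemma exists_func_coefficient_smul {μ : BerSection n F E} (hμ : IsBerezinianForm μ) (p : M)
    (φ : C^∞⟮𝓡 n, M; ℝ⟯) (hφ : tsupport φ ⊆ trivDomain F E p)
    (J : Fin (Module.finrank ℝ (ExteriorAlgebra ℝ (Module.Dual ℝ F))))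
    {η : ∀ x : M, TopForm n x} (hη : IsSmoothForm η) :
    ∃ g : Func n F E, ∀ f : Func n F E,
      berPairing (f * g) μ = fun x => coefficient p φ hφ J f x • η x := by
  obtain ⟨g, hg⟩ := exists_func_berPairing_mul_eq hμ
    (fun x => (φ x • ((fiberBasis F).coord J ∘ₗ (funCoord F E p x).toLinearMap)).smulRight (η x))
    (fun x w => by
      have hxt : x ∈ (tangentTriv n x).baseSet := mem_baseSet_iff.2 (mem_extChartAt_source x)
      by_cases hx : x ∈ trivDomain F E p
      · exact ((φ.contMDiff x).mul (contMDiffAt_funCoord_funCoordInv hx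
          (mem_baseSet_trivializationAt F E x) w ((fiberBasis F).coord J))).mul (hη x x hxt)
      · refine contMDiffAt_of_eventually_eq_zero ?_
        filter_upwards [notMem_tsupport_iff_eventuallyEq.1 fun h => hx (hφ h)] with y hy
        refine formCoord_eq_zero ?_
        rw [LinearMap.smulRight_apply, LinearMap.smul_apply, hy, Pi.zero_apply, zero_smul,
          zero_smul])
  exact ⟨g, fun f => funext fun x => hg f x⟩

end Berezinian

/-! ### The divergence operator -/

section Divergence

open Bundle

variable {n : ℕ} {M : Type*} [TopologicalSpace M] [ChartedSpace (EuclideanSpace ℝ (Fin n)) M]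
  {F : Type*} [NormedAddCommGroup F] [NormedSpace ℝ F] [FiniteDimensional ℝ F]
  {E : M → Type*} [∀ x, AddCommGroup (E x)] [∀ x, Module ℝ (E x)]
  [∀ x, TopologicalSpace (E x)] [TopologicalSpace (Bundle.TotalSpace F E)]
  [FiberBundle F E] [VectorBundle ℝ F E]

lemma isHomogeneous_ofSmooth (gr : OddGrading n F E) (h : C^∞⟮𝓡 n, M; ℝ⟯) :
    gr.IsHomogeneous 0 (ofSmooth F E h) := by
  intro x
  have h1 : (ofSmooth F E h).1 x = h x • 1 := Algebra.algebraMap_eq_smul_one _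
  rw [h1]
  exact Submodule.smul_mem _ _ (Submodule.subset_span ⟨[], by simp, by simp, by simp⟩)

/-- Smooth functions on `M` have degree `0`, so that the Leibniz rule for the product with such a
function involves no signs, and it passes from graded derivations to their linear combinations. -/
lemma vectorField_ofSmooth_mul (gr : OddGrading n F E) {X : Module.End ℝ (Func n F E)}
    (hX : X ∈ gr.VectorField) (h : C^∞⟮𝓡 n, M; ℝ⟯) (f : Func n F E) :
    X (ofSmooth F E h * f) = X (ofSmooth F E h) * f + ofSmooth F E h * X f := by
  induction hX using Submodule.span_induction with
  | mem D hD =>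
    obtain ⟨j, hD⟩ := hD
    have := hD.2 0 _ f (isHomogeneous_ofSmooth gr h)
    simpa using this
  | zero => simp
  | add X Y _ _ hX hY =>
    simp only [LinearMap.add_apply, hX, hY]
    rw [add_mul, mul_add, add_add_add_comm]
  | smul c X _ hX =>
    simp only [LinearMap.smul_apply, hX, smul_add, smul_mul_assoc, mul_smul_comm]

/-- Every function on `E` is a combination of finitely many fixed functions, with smooth functions
on `M` as coefficients. -/
lemma eq_sum_coefficient_mul [CompactSpace M] [ContMDiffVectorBundle ∞ F E (𝓡 n)]
    {σ : SmoothPartitionOfUnity M (𝓡 n) M Set.univ}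
    (hσ : ∀ q, tsupport (σ q) ⊆ trivDomain F E q) {φ : M → C^∞⟮𝓡 n, M; ℝ⟯}
    (hφ1 : ∀ q, ∀ x ∈ tsupport (σ q), φ q x = 1) (hφ : ∀ q, tsupport (φ q) ⊆ trivDomain F E q)
    (f : Func n F E) : f = ∑ q ∈ indices σ, ∑ J, ofSmooth F E (coefficient q (σ q) (hσ q) J f) *
      extendConst q (φ q) (hφ q) (fiberBasis F J) := by
  refine Subtype.ext (funext fun x => ?_)
  simp only [AddSubmonoidClass.coe_finsetSum, Finset.sum_apply]
  have h2 : ∀ q, ∑ J, (ofSmooth F E (coefficient q (σ q) (hσ q) J f) *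
      extendConst q (φ q) (hφ q) (fiberBasis F J)).1 x = σ q x • f.1 x := by
    intro q
    by_cases hx : x ∈ tsupport (σ q)
    · have h3 := linear_apply_eq_sum (funCoordInv F E q x).toLinearMap (funCoord F E q x (f.1 x))
      rw [AlgHom.toLinearMap_apply, funCoordInv_funCoord (hσ q hx)] at h3
      rw [h3, Finset.smul_sum]
      refine Finset.sum_congr rfl fun J _ => ?_
      rw [ofSmooth_mul_apply]
      change (σ q x * _) • (φ q x • _) = _
      rw [hφ1 q x hx, one_smul, mul_smul]
      rfl
    · rw [image_eq_zero_of_notMem_tsupport hx, zero_smul]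
      refine Finset.sum_eq_zero fun J _ => ?_
      rw [ofSmooth_mul_apply]
      change (σ q x * _) • _ = _
      rw [image_eq_zero_of_notMem_tsupport hx, zero_mul, zero_smul]
  simp only [h2]
  rw [← Finset.sum_smul, sum_indices, one_smul]

variable [IsManifold (𝓡 n) ∞ M] [T2Space M] [CompactSpace M]

/-- For a fixed function `θ` on `E` and a vector field `X`, the map `h ↦ ⟨X(h) θ | μ⟩` is a
derivation of `C^∞(M)` with values in the forms of top degree, to which the divergence theorem applies. -/
lemma exists_form_vectorField_ofSmooth_mul (o : ManifoldOrientation n M) (gr : OddGrading n F E)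
    (μ : BerSection n F E) (X : gr.VectorField) (θ : Func n F E) :
    ∃ β : ∀ x : M, TopForm n x, IsSmoothForm β ∧ ∀ h : C^∞⟮𝓡 n, M; ℝ⟯,
      berIntegral o (X.1 (ofSmooth F E h) * θ) μ = - formIntegral o (fun x => h x • β x) := by
  let δ : C^∞⟮𝓡 n, M; ℝ⟯ →ₗ[ℝ] (∀ x : M, TopForm n x) :=
    { toFun := fun h => berPairing (X.1 (ofSmooth F E h) * θ) μ
      map_add' := fun h k => by rw [map_add, map_add, add_mul, berPairing_add]
      map_smul' := fun c h => by
        rw [map_smul, map_smul, smul_mul_assoc, berPairing_smul, RingHom.id_apply] }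
  refine exists_divergence_form o (δ := δ) (fun h => isSmoothForm_berPairing _ _)
    fun h k x => ?_
  have hcomm : X.1 (ofSmooth F E h) * ofSmooth F E k = ofSmooth F E k * X.1 (ofSmooth F E h) :=
    Subtype.ext (funext fun x => (Algebra.commutes (k x) ((X.1 (ofSmooth F E h)).1 x)).symm)
  have h1 : X.1 (ofSmooth F E (h * k)) * θ = ofSmooth F E h * (X.1 (ofSmooth F E k) * θ) +
      ofSmooth F E k * (X.1 (ofSmooth F E h) * θ) := by
    rw [map_mul, vectorField_ofSmooth_mul gr X.2, hcomm, add_mul, mul_assoc, mul_assoc, add_comm]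
  change berPairing (X.1 (ofSmooth F E (h * k)) * θ) μ x = _
  rw [h1, berPairing_add, berPairing_ofSmooth_mul, berPairing_ofSmooth_mul]
  rfl

variable [ContMDiffVectorBundle ∞ F E (𝓡 n)]

/-- The functional `f ↦ ∫ X(h θ) μ`, where `h` is a cut-off coefficient of `f`, is represented by a
function on `E`. -/
lemma exists_func_vectorField_coefficient_mul (o : ManifoldOrientation n M) (gr : OddGrading n F E)
    {μ : BerSection n F E} (hμ : IsBerezinianForm μ) (X : gr.VectorField) (p : M)
    (φ : C^∞⟮𝓡 n, M; ℝ⟯) (hφ : tsupport φ ⊆ trivDomain F E p)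
    (J : Fin (Module.finrank ℝ (ExteriorAlgebra ℝ (Module.Dual ℝ F)))) (θ : Func n F E) :
    ∃ g : Func n F E, ∀ f, berIntegral o (X.1 (ofSmooth F E (coefficient p φ hφ J f) * θ)) μ =
      berIntegral o (f * g) μ := by
  obtain ⟨β, hβ, hβX⟩ := exists_form_vectorField_ofSmooth_mul o gr μ X θ
  have hneg : IsSmoothForm (fun x => (-1 : ℝ) • β x) :=
    hβ.smul (h := fun _ => -1) contMDiff_const
  obtain ⟨g, hg⟩ := exists_func_coefficient_smul hμ p φ hφ J
    ((isSmoothForm_berPairing (X.1 θ) μ).add hneg)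
  refine ⟨g, fun f => ?_⟩
  set k := coefficient p φ hφ J f with hk
  have h2 : (fun x => k x • (berPairing (X.1 θ) μ + fun x => (-1 : ℝ) • β x) x) =
      (fun x => k x • berPairing (X.1 θ) μ x) + (-1 : ℝ) • fun x => k x • β x := by
    funext x
    refine (smul_add (k x) _ _).trans (congrArg (k x • berPairing (X.1 θ) μ x + ·) ?_)
    exact smul_comm (k x) (-1 : ℝ) (β x)
  have h3 : IsSmoothForm (fun x => k x • berPairing (X.1 θ) μ x) :=
    (isSmoothForm_berPairing _ _).smul k.contMDiff
  have h4 : IsSmoothForm ((-1 : ℝ) • fun x => k x • β x) :=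
    (hβ.smul k.contMDiff).smul (h := fun _ => -1) contMDiff_const
  have h5 : berIntegral o (f * g) μ =
      formIntegral o (fun x => k x • berPairing (X.1 θ) μ x) +
        -1 * formIntegral o (fun x => k x • β x) := by
    rw [berIntegral, hg f, ← hk, h2, formIntegral_add o h3 h4, formIntegral_smul]
  have h6 : berIntegral o (ofSmooth F E k * X.1 θ) μ =
      formIntegral o (fun x => k x • berPairing (X.1 θ) μ x) := by
    rw [berIntegral, berPairing_ofSmooth_mul]
  rw [vectorField_ofSmooth_mul gr X.2, berIntegral_add, hβX, h5, h6]
  ring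

/-- Existence of the divergence of a vector field. -/
theorem exists_divergence (o : ManifoldOrientation n M) (gr : OddGrading n F E)
    {μ : BerSection n F E} (hμ : IsBerezinianForm μ) (X : gr.VectorField) :
    ∃ g : Func n F E, ∀ f, berIntegral o (X.1 f) μ = - berIntegral o (f * g) μ := by
  obtain ⟨σ, hσ⟩ := SmoothPartitionOfUnity.exists_isSubordinate (𝓡 n) (isClosed_univ (X := M))
    (fun q => trivDomain F E q) (fun q => (trivializationAt F E q).open_baseSet)
    (fun x _ => Set.mem_iUnion.2 ⟨x, mem_baseSet_trivializationAt F E x⟩)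
  choose φ hφ1 hφ using fun q : M => exists_bump (n := n) (isClosed_tsupport (σ q))
    (trivializationAt F E q).open_baseSet (hσ q)
  choose g hg using fun q J => exists_func_vectorField_coefficient_mul o gr hμ X q (σ q) (hσ q) J
    (extendConst q (φ q) (hφ q) (fiberBasis F J))
  refine ⟨(-1 : ℝ) • ∑ q ∈ indices σ, ∑ J, g q J, fun f => ?_⟩
  rw [mul_smul_comm, berIntegral_smul, neg_one_mul, neg_neg]
  conv_lhs => rw [eq_sum_coefficient_mul hσ (fun q x hx => (hφ1 q x hx).self_of_nhds) hφ f]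
  simp only [map_sum, Finset.mul_sum, berIntegral_sum, hg]

/-- The pairing `(f, g) ↦ ∫ f g μ` is nondegenerate. -/
theorem eq_zero_of_forall_berIntegral_eq_zero (o : ManifoldOrientation n M)
    {μ : BerSection n F E} (hμ : IsBerezinianForm μ) {g : Func n F E}
    (h : ∀ f, berIntegral o (f * g) μ = 0) : g = 0 := by
  refine Subtype.ext (funext fun x => ?_)
  by_contra hg
  have : FiniteDimensional ℝ (E x) := finiteDimensional_fiber F x
  obtain ⟨c, hc⟩ := exists_fiberPairing_mul_ne_zero (hμ x) hg
  have hx : x ∈ trivDomain F E x := mem_baseSet_trivializationAt F E x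
  obtain ⟨φ, hφ1, hφ⟩ := exists_bump (n := n) (isClosed_singleton (x := x))
    (trivializationAt F E x).open_baseSet (Set.singleton_subset_iff.2 hx)
  let f := extendConst (E := E) x φ hφ (funCoord F E x x c)
  have hfx : f.1 x = c := by
    change φ x • _ = _
    rw [(hφ1 x rfl).self_of_nhds, one_smul, funCoordInv_funCoord hx]
  have h1 := eq_zero_of_forall_formIntegral_smul_eq_zero o (isSmoothForm_berPairing (f * g) μ)
    fun k => by
      have h2 := h (ofSmooth F E k * f)
      rw [mul_assoc] at h2
      rw [← h2]
      refine congrArg (formIntegral o) (funext fun y => ?_)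
      refine ((map_smul (fiberPairing (μ.1 y)) (k y) ((f * g).1 y)).symm.trans ?_)
      rw [← ofSmooth_mul_apply]
      rfl
  refine hc ?_
  have h3 := congrFun h1 x
  rw [berPairing_eq] at h3
  have h4 : (f * g).1 x = c * g.1 x := by rw [← hfx]; rfl
  rw [h4] at h3
  exact h3

end Divergence

end OddBundle

end

theorem mainTheorem3 {n : ℕ} {M : Type*} [TopologicalSpace M]
    [ChartedSpace (EuclideanSpace ℝ (Fin n)) M] [IsManifold (𝓡 n) ∞ M]
    [T2Space M] [CompactSpace M] (o : OddBundle.ManifoldOrientation n M)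
    {F : Type*} [NormedAddCommGroup F] [NormedSpace ℝ F] [FiniteDimensional ℝ F]
    {E : M → Type*} [∀ x, AddCommGroup (E x)] [∀ x, Module ℝ (E x)]
    [∀ x, TopologicalSpace (E x)] [TopologicalSpace (Bundle.TotalSpace F E)]
    [FiberBundle F E] [VectorBundle ℝ F E] [ContMDiffVectorBundle ∞ F E (𝓡 n)]
    (gr : OddBundle.OddGrading n F E) :
    ∃ div : OddBundle.BerSection n F E → gr.VectorField → OddBundle.Func n F E,
      (∀ μ, OddBundle.IsBerezinianForm μ → OddBundle.IsDivergence o gr μ (div μ)) ∧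
      (∀ μ, OddBundle.IsBerezinianForm μ → ∀ D, OddBundle.IsDivergence o gr μ D → D = div μ) ∧
      (∀ μ, OddBundle.IsBerezinianForm μ → ∀ c : ℝ, c ≠ 0 → div (c • μ) = div μ) := by
  classical
  choose div hdiv using fun (μ : OddBundle.BerSection n F E) (hμ : OddBundle.IsBerezinianForm μ)
    (X : gr.VectorField) => OddBundle.exists_divergence o gr hμ X
  have hunique : ∀ μ, OddBundle.IsBerezinianForm μ → ∀ D D', OddBundle.IsDivergence o gr μ D →
      OddBundle.IsDivergence o gr μ D' → D = D' := by
    intro μ hμ D D' hD hD'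
    funext X
    rw [← sub_eq_zero]
    refine OddBundle.eq_zero_of_forall_berIntegral_eq_zero o hμ fun f => ?_
    have h1 : f * D X = f * (D X - D' X) + f * D' X := by rw [← mul_add, sub_add_cancel]
    have h2 := OddBundle.berIntegral_add o (f * (D X - D' X)) (f * D' X) μ
    rw [← h1] at h2
    linarith [hD X f, hD' X f]
  have hex : ∀ μ (hμ : OddBundle.IsBerezinianForm μ),
      OddBundle.IsDivergence o gr μ (div μ hμ) := fun μ hμ X f => hdiv μ hμ X f
  refine ⟨fun μ => if hμ : OddBundle.IsBerezinianForm μ then div μ hμ else 0, ?_, ?_, ?_⟩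
  · intro μ hμ
    simp only [dif_pos hμ]
    exact hex μ hμ
  · intro μ hμ D hD
    simp only [dif_pos hμ]
    exact hunique μ hμ D _ hD (hex μ hμ)
  · intro μ hμ c hc
    have hcμ : OddBundle.IsBerezinianForm (c • μ) := by
      intro x h
      have h1 : (c • μ).1 x = c • μ.1 x := rfl
      rw [h1, map_smul] at h
      exact hμ x ((smul_eq_zero.1 h).resolve_left hc)
    have hint : ∀ f, OddBundle.berIntegral o f (c • μ) = c * OddBundle.berIntegral o f μ := by
      intro f
      have : OddBundle.berPairing f (c • μ) = c • OddBundle.berPairing f μ := by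
        funext x
        have h1 : (c • μ).1 x = c • μ.1 x := rfl
        rw [OddBundle.berPairing, h1, map_smul, map_smul]
        rfl
      rw [OddBundle.berIntegral, this, OddBundle.formIntegral_smul]
      rfl
    simp only [dif_pos hμ, dif_pos hcμ]
    refine hunique _ hcμ _ _ (hex _ hcμ) fun X f => ?_
    rw [hint, hint, hex μ hμ X f, mul_neg]
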